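/- Let $\tilde h(k)=(2\pi)^{-1/2}\int e^{-ikx}h(x)\,dx$. On the Fock space of a massless charged (complex) right-moving scalar field in $1+1$ dimensions, with particle operators $a(k)$ and antiparticle operators $b(k)$ ($k>0$), $[a(k),a^\dagger(k')]=[b(k),b^\dagger(k')]=2k\,\delta(k-k')$, and incoming vacuum $\Omega_o$, let $$\phi(x)=\frac1{\sqrt{2\pi}}\int_0^\infty\frac{dk}{2k}\left[a(k)e^{-ikx}+b^\dagger(k)e^{ikx}\right],\qquad \phi[h]=\int h(x)\phi(x)\,dx .$$ Let $x=x(y)$ be a smooth change of coordinates $\mathbb R\to\mathbb R$ with $x'(y)>0$, and let $\hat\phi(y)=\phi(x(y))$ be the outgoing field, whose outgoing operators $a_{out}(p),b_{out}(p)$ are given by $\hat\phi(y)=\frac1{\sqrt{2\pi}}\int_0^\infty\frac{dp}{2p}[a_{out}(p)e^{-ipy}+b_{out}^\dagger(p)e^{ipy}]$. The two black-hole models are $x(y)=-e^{-y}$ (relativistic) and $x(y)=-\log(1+e^{-y})$ (CGHS); both are such changes of coordinates. Let $g$ be a Schwartz function on $\mathbb R$ with $\tilde g(k)=0$ for $k<0$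 and $\int_0^\infty\frac{dk}{2k}|\tilde g(k)|^2=1$, and let $G(x)=\int_{-\infty}^x g(x')\,dx'$. Let $\Omega_g=\phi[g]^\dagger\Omega_o$ be the one-particle state and $\bar\Omega_g=\phi[g^*]\,\Omega_o$ the one-antiparticle state. Denote by $J_g(x),\hat J_g(y)$ the mean currents of $\Omega_g$ in the incoming and outgoing coordinates, and by $J_{g^*}(x),\hat J_{g^*}(y)$ those of $\bar\Omega_g$, where, with $A\overset{\leftrightarrow}{\partial}B=A\,\partial B-(\partial A)\,B$, the mean current of a state $\Psi$ is defined in either of two ways: * (normal ordering) $(\Psi,:\!i\,\phi^\dagger\overset{\leftrightarrow}{\partial}_x\phi(x)\!:_{in}\Psi)$ and $(\Psi,:\!i\,\hat\phi^\dagger\overset{\leftrightarrow}{\partial}_y\hat\phi(y)\!:_{out}\Psi)$, ordered with respect to $a,b$ and to $a_{out},b_{out}$ respectively; * (subtraction) $\lim_{\varepsilon\to0}[(\Psi,\Upsilon_\varepsilon(x)\Psi)-(\Omega_o,\Upsilon_\varepsilon(x)\Omega_o)]$ and $\lim_{\varepsilon\to0}[(\Psi,\hat\Upsilon_\varepsilon(y)\Psi)-(\Omega_o,\Upsilon_\varepsilon(x(y))\Omega_o)]$,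 where $\Upsilon_\varepsilon(x)=i[\phi(x+\varepsilon)^\dagger\partial_x\phi(x)-\partial_x\phi(x)^\dagger\,\phi(x+\varepsilon)]$ and $\hat\Upsilon_\varepsilon$ is the same expression in $\hat\phi$, $y$. Mean values at a point are limits of those with cut-offs: modes $k\le\eta$ are left out and the others damped by $e^{-\eta k}$; in the integrals over $y$ which express $a_{out},b_{out}$ through $\hat\phi$ a spatial cut-off $\chi(\delta y)$ is inserted ($\chi\in C_c^\infty(\mathbb R)$ real, $\chi(0)=1$), and normal-ordered products of two creation, or of two annihilation, operators are symmetrized; then $\eta,\delta\to0^+$ (independently, and for every $\chi$). Then, for both definitions, these mean currents exist at every point, and $$J_g(x)=-J_{g^*}(x)=-\tfrac i4\,G(x)^*\overset{\leftrightarrow}{\partial}_xG(x),\qquad \hat J_g(y)=-\hat J_{g^*}(y)=-\tfrac i4\,G(x(y))^*\overset{\leftrightarrow}{\partial}_yG(x(y)).$$ The incoming charges $Q^{in}=\int_{-\infty}^{\infty}J(x)\,dx$ converge absolutely, and $Q^{in}_g=-Q^{in}_{g^*}=1$. For both black-hole models the outgoing charges $Q^{out}=\int_{-\infty}^\infty\hat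 J(y)\,dy$ converge absolutely, and $$Q^{out}_g=-Q^{out}_{g^*}=\int_{-\infty}^0J_g(x)\,dx .$$ Moreover there is such a $g$ for which $Q^{out}_g<0$ in both models. -/

import Mathlib

open MeasureTheory Filter Topology Complex ComplexConjugate
open scoped ContDiff

namespace ChargedField

noncomputable section

/-! ### Test functions -/

/-- The Fourier transform `(2π)^(-1/2) ∫ exp(-ikx) h(x) dx`. -/
def ft (h : ℝ → ℂ) (k : ℝ) : ℂ :=
  (1 / (Real.sqrt (2 * Real.pi) : ℂ)) * ∫ x : ℝ, exp (-(I * k * x)) * h x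

/-- The measure `dk / (2k)` on the half-line `k > 0`. -/
def modeMeasure : Measure ℝ :=
  (volume.restrict (Set.Ioi (0 : ℝ))).withDensity fun k => ENNReal.ofReal (1 / (2 * k))

/-- Schwartz functions without negative momenta whose Fourier transform is normalized in
`L²(dk/2k, (0, ∞))`. -/
def IsNormalizedTest (g : SchwartzMap ℝ ℂ) : Prop :=
  (∀ k : ℝ, k < 0 → ft g k = 0) ∧ ∫ k, ‖ft g k‖ ^ 2 ∂modeMeasure = 1

/-- The primitive of `g` that vanishes at `-∞`. -/
def primitive (g : ℝ → ℂ) (x : ℝ) : ℂ := ∫ t in Set.Iic x, g t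

/-- The two-sided derivative `A ∂ B - (∂ A) B`. -/
def biDeriv (A B : ℝ → ℂ) (x : ℝ) : ℂ := A x * deriv B x - deriv A x * B x

/-! ### The incoming Fock space

A vector is given by its wave functions `Ψ m n K L`, the amplitude for `m` particles of momenta
`K` and `n` antiparticles of momenta `L` (symmetric in `K` and in `L` for every vector which is
obtained from the vacuum by the operators below).  -/

abbrev FockVec : Type := (m n : ℕ) → (Fin m → ℝ) → (Fin n → ℝ) → ℂ

abbrev FockOp : Type := FockVec → FockVec

/-- The scalar product, antilinear in the first argument. -/
def fockInner (Ψ Φ : FockVec) : ℂ :=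
  ∑' m : ℕ, ∑' n : ℕ,
    ∫ K : Fin m → ℝ, ∫ L : Fin n → ℝ, conj (Ψ m n K L) * Φ m n K L
      ∂(Measure.pi fun _ => modeMeasure) ∂(Measure.pi fun _ => modeMeasure)

/-- The mean value `(Ψ, A Ψ)`. -/
def mean (Ψ : FockVec) (A : FockOp) : ℂ := fockInner Ψ (A Ψ)

/-- The incoming vacuum. -/
def vacuum : FockVec := fun m n _ _ => if m = 0 ∧ n = 0 then 1 else 0

/-- `∫ dk/(2k) u(k) a(k)`, where `a(k)` annihilates a particle and
`[a(k), a†(k')] = 2 k δ(k - k')`. -/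
def annA (u : ℝ → ℂ) : FockOp := fun Ψ m n K L =>
  (Real.sqrt ((m : ℝ) + 1) : ℂ) * ∫ k, u k * Ψ (m + 1) n (Fin.cons k K) L ∂modeMeasure

/-- `∫ dk/(2k) v(k) a†(k)`, where `a†(k)` creates a particle. -/
def creA (v : ℝ → ℂ) : FockOp := fun Ψ m n K L =>
  match m, K with
  | 0, _ => 0
  | m + 1, K => (1 / (Real.sqrt ((m : ℝ) + 1) : ℂ)) *
      ∑ i : Fin (m + 1), v (K i) * Ψ m n (fun j => K (i.succAbove j)) L

/-- `∫ dk/(2k) u(k) b(k)`, where `b(k)` annihilates an antiparticle and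
`[b(k), b†(k')] = 2 k δ(k - k')`. -/
def annB (u : ℝ → ℂ) : FockOp := fun Ψ m n K L =>
  (Real.sqrt ((n : ℝ) + 1) : ℂ) * ∫ k, u k * Ψ m (n + 1) K (Fin.cons k L) ∂modeMeasure

/-- `∫ dk/(2k) v(k) b†(k)`, where `b†(k)` creates an antiparticle. -/
def creB (v : ℝ → ℂ) : FockOp := fun Ψ m n K L =>
  match n, L with
  | 0, _ => 0
  | n + 1, L => (1 / (Real.sqrt ((n : ℝ) + 1) : ℂ)) *
      ∑ i : Fin (n + 1), v (L i) * Ψ m n K (fun j => L (i.succAbove j))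

/-- `∫_0^∞ dk/(2k) [c(k) a(k) + c(-k) b†(k)]`. For `c = ft h` this is the smeared complex field
`φ[h] = ∫ h(x) φ(x) dx`, where
`φ(x) = (2π)^(-1/2) ∫_0^∞ dk/(2k) [a(k) exp(-ikx) + b†(k) exp(ikx)]`. -/
def field (c : ℝ → ℂ) : FockOp := annA c + creB fun k => c (-k)

/-- The adjoint `∫_0^∞ dk/(2k) [c(k)* a†(k) + c(-k)* b(k)]` of `field c`. -/
def fieldAdj (c : ℝ → ℂ) : FockOp := (creA fun k => conj (c k)) + annB fun k => conj (c (-k))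

/-- The one-particle state `φ[g]† Ω`. -/
def oneParticle (g : ℝ → ℂ) : FockVec := fieldAdj (ft g) vacuum

/-- The one-antiparticle state `φ[g*] Ω`, the charge conjugate of `φ[g]† Ω`. -/
def oneAntiparticle (g : ℝ → ℂ) : FockVec := field (ft fun x => conj (g x)) vacuum

/-! ### Fields at a point

The massless field at a point is reached from the field with the modes `|k| ≤ η` left out and the
others damped by `exp(-η |k|)`; the damping is the usual prescription `+ i 0⁺`. Mean values are
computed at `η > 0`, and then `η → 0⁺`. -/

/-- The cut-off factor of the mode `k`. -/
def cutoff (η k : ℝ) : ℝ := if η < |k| then Real.exp (-(η * |k|)) else 0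

/-- The modes of `φ(x)`, with the cut-off. -/
def inMode (η x k : ℝ) : ℂ :=
  (cutoff η k : ℂ) * exp (-(I * k * x)) / (Real.sqrt (2 * Real.pi) : ℂ)

/-- A change of coordinates `x = X(y)` from outgoing to incoming coordinates; the outgoing field
is `φ(X(y))`. -/
def IsCoordChange (X : ℝ → ℝ) : Prop := ContDiff ℝ ∞ X ∧ ∀ y, 0 < deriv X y

/-- The relativistic black hole (`M = 1`, `Δ = 0`). -/
def rbh (y : ℝ) : ℝ := -Real.exp (-y)

/-- The CGHS black hole (`M = λ = 1`, `x₀ = 0`). -/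
def cghs (y : ℝ) : ℝ := -Real.log (1 + Real.exp (-y))

/-- The point-split current `i [φ(X(y+ε))† ∂φ(X(y)) - ∂φ(X(y))† φ(X(y+ε))]`, `∂ = d/dy`, with
the cut-off `η`; `X = id` gives the one in the incoming coordinates. -/
def splitCurrent (X : ℝ → ℝ) (η ε y : ℝ) : FockOp :=
  I • (fieldAdj (inMode η (X (y + ε))) ∘ field (fun k => deriv (fun z => inMode η (X z) k) y) -
    fieldAdj (fun k => deriv (fun z => inMode η (X z) k) y) ∘ field (inMode η (X (y + ε))))

/-- `V` is the mean value, in the state `Ψ`, of the point-split current at separation `ε`. -/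
def HasSplitMean (X : ℝ → ℝ) (Ψ : FockVec) (ε y : ℝ) (V : ℂ) : Prop :=
  Tendsto (fun η : ℝ => mean Ψ (splitCurrent X η ε y)) (𝓝[>] 0) (𝓝 V)

/-- The normal-ordered product `:(Xc + Xa)(Yc + Ya):` for sums of a creation part (`Xc`, `Yc`) and
an annihilation part (`Xa`, `Ya`). The products of two parts of the same kind, which commute
without cut-off, are symmetrized, so that `:XY: = :YX:` with a cut-off too. -/
def normalProduct (Xc Xa Yc Ya : FockOp) : FockOp :=
  Xc ∘ Ya + Yc ∘ Xa + (1 / 2 : ℂ) • (Xc ∘ Yc + Yc ∘ Xc) + (1 / 2 : ℂ) • (Xa ∘ Ya + Ya ∘ Xa)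

/-- The normal-ordered current `i [:φ† ∂φ: - :∂φ† φ:]` of a field whose modes at the point `y` are
`cp y` (annihilation of particles) and `cm y` (creation of antiparticles). -/
def normalCurrent (cp cm : ℝ → ℝ → ℂ) (y : ℝ) : FockOp :=
  let dp : ℝ → ℂ := fun k => deriv (fun z => cp z k) y
  let dm : ℝ → ℂ := fun k => deriv (fun z => cm z k) y
  I • (normalProduct (fieldAdj (cp y)) (fieldAdj (cm y)) (field dm) (field dp) -
    normalProduct (fieldAdj dp) (fieldAdj dm) (field (cm y)) (field (cp y)))

/-- The part of `φ(x)` with the operators `a(k)`. -/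
def inPos (η x k : ℝ) : ℂ := if 0 < k then inMode η x k else 0

/-- The part of `φ(x)` with the operators `b†(k)`. -/
def inNeg (η x k : ℝ) : ℂ := if k < 0 then inMode η x k else 0

/-- The kernel `(2π)^(-1) ∫ exp(-i k X(y)) exp(i p y) dy`, an oscillatory integral, with a
spatial cut-off `χ`. -/
def kernelU (X χ : ℝ → ℝ) (k p : ℝ) : ℂ :=
  (1 / (2 * Real.pi : ℂ)) *
    ∫ y : ℝ, exp (-(I * k * (X y : ℂ))) * exp (I * p * y) * (χ y : ℂ)

/-- The coefficients of the outgoing annihilation operator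
`a_out(p) = (2p / √(2π)) ∫ exp(ipy) φ(X(y)) dy` of particles (`p > 0`). -/
def aOut (X χ : ℝ → ℝ) (η p k : ℝ) : ℂ := 2 * p * cutoff η k * kernelU X χ k p

/-- The coefficients of the outgoing creation operator
`b_out†(p) = (2p / √(2π)) ∫ exp(-ipy) φ(X(y)) dy` of antiparticles (`p > 0`). -/
def bOutDag (X χ : ℝ → ℝ) (η p k : ℝ) : ℂ := 2 * p * cutoff η k * kernelU X χ k (-p)

/-- The coefficients of `(2π)^(-1/2) ∫_0^∞ dp/(2p) a_out(p) exp(-ipy)`. -/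
def outPos (X χ : ℝ → ℝ) (η y k : ℝ) : ℂ :=
  (1 / (Real.sqrt (2 * Real.pi) : ℂ)) * ∫ p, exp (-(I * p * y)) * aOut X χ η p k ∂modeMeasure

/-- The coefficients of `(2π)^(-1/2) ∫_0^∞ dp/(2p) b_out†(p) exp(ipy)`. -/
def outNeg (X χ : ℝ → ℝ) (η y k : ℝ) : ℂ :=
  (1 / (Real.sqrt (2 * Real.pi) : ℂ)) * ∫ p, exp (I * p * y) * bOutDag X χ η p k ∂modeMeasure

/-- The two ways in which the mean current is regularized. -/
inductive Scheme
  | normalOrdering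
  | subtraction

/-- `J` is the mean current at `x` of the state `Ψ`, in the incoming coordinates. -/
def HasInCurrent (s : Scheme) (Ψ : FockVec) (x : ℝ) (J : ℂ) : Prop :=
  match s with
  | .normalOrdering =>
      Tendsto (fun η : ℝ => mean Ψ (normalCurrent (inPos η) (inNeg η) x)) (𝓝[>] 0) (𝓝 J)
  | .subtraction =>
      ∃ V V₀ : ℝ → ℂ,
        (∀ ε ≠ 0, HasSplitMean id Ψ ε x (V ε) ∧ HasSplitMean id vacuum ε x (V₀ ε)) ∧
        Tendsto (fun ε => V ε - V₀ ε) (𝓝[≠] 0) (𝓝 J)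

/-- `J` is the mean current at `y` of the state `Ψ`, in the outgoing coordinates. In the normal
ordering scheme, which refers to the operators `a_out`, `b_out`, the spatial cut-off is any
`χ(δ y)` with `χ` a test function, `χ(0) = 1`, and the cut-offs are removed independently of each
other. -/
def HasOutCurrent (s : Scheme) (X : ℝ → ℝ) (Ψ : FockVec) (y : ℝ) (J : ℂ) : Prop :=
  match s with
  | .normalOrdering =>
      ∀ χ : ℝ → ℝ, ContDiff ℝ ∞ χ → HasCompactSupport χ → χ 0 = 1 →
        Tendsto (fun q : ℝ × ℝ => mean Ψ (normalCurrent
          (outPos X (fun z => χ (q.2 * z)) q.1) (outNeg X (fun z => χ (q.2 * z)) q.1) y))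
          ((𝓝[>] 0) ×ˢ (𝓝[>] 0)) (𝓝 J)
  | .subtraction =>
      ∃ V V₀ : ℝ → ℂ,
        (∀ ε ≠ 0, HasSplitMean X Ψ ε y (V ε) ∧ HasSplitMean id vacuum ε (X y) (V₀ ε)) ∧
        Tendsto (fun ε => V ε - V₀ ε) (𝓝[≠] 0) (𝓝 J)

end

end ChargedField

open ChargedField

namespace ChargedField

noncomputable section

open scoped FourierTransform SchwartzMap

/-! ### One-particle amplitudes -/

/-! The state of `g` has a single particle with wave function `w = conj (ft g)`; its charge
conjugate has a single antiparticle with the same `w` (`oneParticle_eq`, `oneAntiparticle_eq`). In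
either state the mean value of an adjoint field with modes `c` times a field with modes `d` is a
product of two pairings with `w` plus a vacuum term that does not involve `w`. Antisymmetrizing in
`c`, `d` turns the pairings into `currentForm`; for the antiparticle `c` and `d` change places,
which gives the opposite sign.

It remains to see that the vacuum terms drop out. In the point-split current they tend to opposite
multiples of the inverse separation (`hasSplitMean_vacuum`). In the normal-ordered current, charge
conjugation, `cp (-k) = conj (cm k)`, makes the vacuum term symmetric in the field and its
derivative, so that it cancels at every value of the cut-offs (`hasMean_normalCurrent`): the pairs
created by the change of coordinates carry no mean current. What is left involves only the sum of
the positive and negative outgoing parts, and Fourier inversion identifies this sum with `χ(y)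
φ(X(y))` (`outPos_add_outNeg`). No Bogoliubov coefficient has to be evaluated. Both schemes thus
give `X'(y)` times `density w (X y)`.

Differentiating a wave cancels the weight `1/(2k)`, so by Fourier inversion the derivative is
`-(i/2) conj g`; since the wave vanishes at `-∞` by the Riemann-Lebesgue lemma, it is `-(i/2) conj
G` (`wave_testWave`). Fubini equates the incoming charge with the norm of `w` (`integral_wave_mul`),
and a substitution onto the range `x < 0` gives the outgoing charge.

Positive momentum does not make the density positive: the amplitude `(1 + 2k) exp(-k)` has density
proportional to `(15 - x²)/(1 + x²)³`. Translation by 4 makes it negative on all of `x < 0`. Smooth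
truncations of this amplitude converge with a uniform `1/x²` majorant, so one of them has negative
charge on `x < 0`, and it is then normalized (`exists_negative_charge`). -/

instance : SigmaFinite modeMeasure := by
  unfold modeMeasure
  exact SigmaFinite.withDensity_ofReal _

/-- The vector with one particle of wave function `w`. -/
def particle (w : ℝ → ℂ) : FockVec
  | 1, 0, K, _ => w (K 0)
  | _, _, _, _ => 0

/-- The vector with one antiparticle of wave function `w`. -/
def antiparticle (w : ℝ → ℂ) : FockVec
  | 0, 1, _, L => w (L 0)
  | _, _, _, _ => 0

/-- The vacuum amplitude. -/
def vacAmp (Φ : FockVec) : ℂ := Φ 0 0 Fin.elim0 Fin.elim0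

/-- The one-particle amplitude. -/
def partAmp (Φ : FockVec) (k : ℝ) : ℂ := Φ 1 0 (fun _ => k) Fin.elim0

/-- The one-antiparticle amplitude. -/
def antiAmp (Φ : FockVec) (k : ℝ) : ℂ := Φ 0 1 Fin.elim0 (fun _ => k)

lemma annA_vacuum (u : ℝ → ℂ) : annA u vacuum = 0 := by
  funext m n K L
  simp [annA, vacuum]

lemma annB_vacuum (u : ℝ → ℂ) : annB u vacuum = 0 := by
  funext m n K L
  simp [annB, vacuum]

lemma creA_vacuum (v : ℝ → ℂ) : creA v vacuum = particle v := by
  funext m n K L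
  match m, n with
  | 0, 0 => rfl
  | 0, _ + 1 => rfl
  | 1, 0 => simp [creA, vacuum, particle]
  | 1, _ + 1 => simp [creA, vacuum, particle]
  | _ + 2, 0 => simp [creA, vacuum, particle]
  | _ + 2, _ + 1 => simp [creA, vacuum, particle]

lemma creB_vacuum (v : ℝ → ℂ) : creB v vacuum = antiparticle v := by
  funext m n K L
  match m, n with
  | 0, 0 => rfl
  | _ + 1, 0 => rfl
  | 0, 1 => simp [creB, vacuum, antiparticle]
  | _ + 1, 1 => simp [creB, vacuum, antiparticle]
  | 0, _ + 2 => simp [creB, vacuum, antiparticle]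
  | _ + 1, _ + 2 => simp [creB, vacuum, antiparticle]

lemma oneParticle_eq (g : ℝ → ℂ) : oneParticle g = particle fun k => conj (ft g k) := by
  simp [oneParticle, fieldAdj, annB_vacuum, creA_vacuum]

lemma ft_conj_neg (g : ℝ → ℂ) (k : ℝ) : ft (fun x => conj (g x)) (-k) = conj (ft g k) := by
  simp only [ft, map_mul, map_div₀, map_one, conj_ofReal, ← integral_conj]
  congr 2
  funext x
  rw [← exp_conj]
  simp

lemma oneAntiparticle_eq (g : ℝ → ℂ) :
    oneAntiparticle g = antiparticle fun k => conj (ft g k) := by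
  simp [oneAntiparticle, field, annA_vacuum, creB_vacuum, ft_conj_neg]

lemma integral_pi_fin_one (f : (Fin 1 → ℝ) → ℂ) :
    ∫ K, f K ∂(Measure.pi fun _ => modeMeasure) = ∫ k, f (fun _ => k) ∂modeMeasure :=
  ((measurePreserving_funUnique modeMeasure (Fin 1)).symm.integral_comp' f).symm

lemma fockInner_vacuum (Φ : FockVec) : fockInner vacuum Φ = vacAmp Φ := by
  unfold fockInner
  rw [tsum_eq_single 0, tsum_eq_single 0]
  · rw [Measure.pi_of_empty _ Fin.elim0]
    simp [vacuum, vacAmp]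
  · intro n hn
    simp [vacuum, hn]
  · intro m hm
    simp [vacuum, hm]

lemma fockInner_particle (w : ℝ → ℂ) (Φ : FockVec) :
    fockInner (particle w) Φ = ∫ k, conj (w k) * partAmp Φ k ∂modeMeasure := by
  unfold fockInner
  rw [tsum_eq_single 1, tsum_eq_single 0]
  · rw [Measure.pi_of_empty (α := Fin 0) _ Fin.elim0, integral_pi_fin_one]
    simp only [integral_dirac]
    rfl
  · intro n hn
    obtain ⟨n, rfl⟩ := Nat.exists_eq_succ_of_ne_zero hn
    simp [particle]
  · intro m hm
    match m with
    | 0 => simp [particle]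
    | m + 2 => simp [particle]

lemma fockInner_antiparticle (w : ℝ → ℂ) (Φ : FockVec) :
    fockInner (antiparticle w) Φ = ∫ k, conj (w k) * antiAmp Φ k ∂modeMeasure := by
  unfold fockInner
  rw [tsum_eq_single 0, tsum_eq_single 1]
  · rw [Measure.pi_of_empty (α := Fin 0) _ Fin.elim0]
    simp only [integral_dirac]
    rw [integral_pi_fin_one]
    rfl
  · intro n hn
    match n with
    | 0 => simp [antiparticle]
    | n + 2 => simp [antiparticle]
  · intro m hm
    obtain ⟨m, rfl⟩ := Nat.exists_eq_succ_of_ne_zero hm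
    simp [antiparticle]

lemma vacAmp_fieldAdj_field (c d : ℝ → ℂ) :
    vacAmp (fieldAdj c (field d vacuum)) = ∫ k, conj (c (-k)) * d (-k) ∂modeMeasure := by
  simp [vacAmp, fieldAdj, field, annA_vacuum, creB_vacuum, creA, annB, antiparticle]

/-- With `s = √2` this is the passage through a two-quantum sector: the factor of annihilation
cancels that of creation, leaving a direct and an exchange term. Integrability is what permits
splitting the sum. -/
lemma symmetrized_integral {s : ℂ} (hs : s ≠ 0) (x y : ℂ) {a f g : ℝ → ℂ}
    (h1 : Integrable (fun l => a l * f l) modeMeasure)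
    (h2 : Integrable (fun l => a l * g l) modeMeasure) :
    s * ∫ l, a l * s⁻¹ * (f l * x + y * g l) ∂modeMeasure =
      y * (∫ l, a l * g l ∂modeMeasure) + (∫ l, a l * f l ∂modeMeasure) * x := by
  have h : ∀ l, a l * s⁻¹ * (f l * x + y * g l) =
      s⁻¹ * (y * (a l * g l) + a l * f l * x) := fun l => by ring
  simp_rw [h]
  rw [integral_const_mul, integral_add (h2.const_mul y) (h1.mul_const x), integral_const_mul,
    integral_mul_const, ← mul_assoc, mul_inv_cancel₀ hs, one_mul]

lemma sqrt_one_add_one_ne_zero : (Real.sqrt (1 + 1) : ℂ) ≠ 0 := by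
  norm_cast
  positivity

/-- The intermediate vectors are the vacuum, or one particle with one antiparticle. Neither contains
two quanta of the same kind, so nothing is symmetrized and no integrability is needed. In the
opposite order two particles occur. -/
lemma partAmp_fieldAdj_field (w c d : ℝ → ℂ) (k : ℝ) :
    partAmp (fieldAdj c (field d (particle w))) k =
      conj (c k) * (∫ l, d l * w l ∂modeMeasure) +
        (∫ l, conj (c (-l)) * d (-l) ∂modeMeasure) * w k := by
  simp [partAmp, fieldAdj, field, creA, annB, annA, creB, particle, ← mul_assoc,
    integral_mul_const]

lemma partAmp_field_fieldAdj (w c d : ℝ → ℂ) (k : ℝ)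
    (h1 : Integrable (fun l => d l * conj (c l)) modeMeasure)
    (h2 : Integrable (fun l => d l * w l) modeMeasure) :
    partAmp (field d (fieldAdj c (particle w))) k =
      conj (c k) * (∫ l, d l * w l ∂modeMeasure) +
        (∫ l, conj (c l) * d l ∂modeMeasure) * w k := by
  simp only [mul_comm (conj (c _)) (d _)]
  rw [← symmetrized_integral sqrt_one_add_one_ne_zero _ _ h1 h2]
  simp [partAmp, fieldAdj, field, creA, annB, annA, creB, particle, ← mul_assoc]

lemma antiAmp_fieldAdj_field (w c d : ℝ → ℂ) (k : ℝ)
    (h1 : Integrable (fun l => conj (c (-l)) * d (-l)) modeMeasure)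
    (h2 : Integrable (fun l => conj (c (-l)) * w l) modeMeasure) :
    antiAmp (fieldAdj c (field d (antiparticle w))) k =
      d (-k) * (∫ l, conj (c (-l)) * w l ∂modeMeasure) +
        (∫ l, conj (c (-l)) * d (-l) ∂modeMeasure) * w k := by
  rw [← symmetrized_integral sqrt_one_add_one_ne_zero _ _ h1 h2]
  simp [antiAmp, fieldAdj, field, creA, annB, annA, creB, antiparticle, ← mul_assoc]

lemma antiAmp_field_fieldAdj (w c d : ℝ → ℂ) (k : ℝ) :
    antiAmp (field d (fieldAdj c (antiparticle w))) k =
      d (-k) * (∫ l, conj (c (-l)) * w l ∂modeMeasure) +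
        (∫ l, conj (c l) * d l ∂modeMeasure) * w k := by
  simp [antiAmp, fieldAdj, field, creA, annB, annA, creB, antiparticle, ← mul_assoc]
  simp only [mul_comm (conj (c _)) (d _), integral_mul_const]
  ring

/-! ### Mean values -/

/-- The operator `A` has an integrable one-particle (or one-antiparticle) mean value `V`. -/
def HasMean (amp : FockVec → ℝ → ℂ) (w : ℝ → ℂ) (Ψ : FockVec) (A : FockOp) (V : ℂ) : Prop :=
  Integrable (fun k => conj (w k) * amp (A Ψ) k) modeMeasure ∧
    ∫ k, conj (w k) * amp (A Ψ) k ∂modeMeasure = V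

/-- Linearity of an amplitude. -/
def IsLinearAmp (amp : FockVec → ℝ → ℂ) : Prop :=
  ∀ (z z' : ℂ) (Φ Φ' : FockVec) (k : ℝ), amp (z • Φ + z' • Φ') k = z * amp Φ k + z' * amp Φ' k

lemma isLinearAmp_partAmp : IsLinearAmp partAmp := fun _ _ _ _ _ => rfl

lemma isLinearAmp_antiAmp : IsLinearAmp antiAmp := fun _ _ _ _ _ => rfl

section

variable {amp : FockVec → ℝ → ℂ} {w : ℝ → ℂ} {Ψ : FockVec} {A B : FockOp} {V W : ℂ}

/-- Mean values are additive only for integrable integrands, which is why `HasMean` carries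
integrability along with the value. -/
lemma HasMean.lin (hl : IsLinearAmp amp) (z z' : ℂ) (hA : HasMean amp w Ψ A V)
    (hB : HasMean amp w Ψ B W) : HasMean amp w Ψ (z • A + z' • B) (z * V + z' * W) := by
  have h : (fun k => conj (w k) * amp ((z • A + z' • B) Ψ) k) =
      fun k => z * (conj (w k) * amp (A Ψ) k) + z' * (conj (w k) * amp (B Ψ) k) := by
    funext k
    rw [Pi.add_apply, Pi.smul_apply, Pi.smul_apply, hl]
    ring
  refine ⟨h ▸ (hA.1.const_mul z).add (hB.1.const_mul z'), ?_⟩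
  rw [h, integral_add (hA.1.const_mul z) (hB.1.const_mul z'), integral_const_mul,
    integral_const_mul, hA.2, hB.2]

lemma HasMean.add (hl : IsLinearAmp amp) (hA : HasMean amp w Ψ A V)
    (hB : HasMean amp w Ψ B W) : HasMean amp w Ψ (A + B) (V + W) := by
  simpa using hA.lin hl 1 1 hB

lemma HasMean.sub (hl : IsLinearAmp amp) (hA : HasMean amp w Ψ A V)
    (hB : HasMean amp w Ψ B W) : HasMean amp w Ψ (A - B) (V - W) := by
  simpa [sub_eq_add_neg] using hA.lin hl 1 (-1) hB

lemma HasMean.smul (hl : IsLinearAmp amp) (z : ℂ) (hA : HasMean amp w Ψ A V) :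
    HasMean amp w Ψ (z • A) (z * V) := by
  simpa using hA.lin hl z 0 hA

end

/-- Square integrable mode functions, at positive and at negative arguments. -/
def IsMode (c : ℝ → ℂ) : Prop :=
  MemLp c 2 modeMeasure ∧ MemLp (fun k => c (-k)) 2 modeMeasure

lemma integrable_mul_conj {u v : ℝ → ℂ} (hu : MemLp u 2 modeMeasure)
    (hv : MemLp v 2 modeMeasure) : Integrable (fun k => u k * conj (v k)) modeMeasure :=
  hu.integrable_mul hv.star

lemma integrable_conj_mul {u v : ℝ → ℂ} (hu : MemLp u 2 modeMeasure)
    (hv : MemLp v 2 modeMeasure) : Integrable (fun k => conj (u k) * v k) modeMeasure :=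
  hu.star.integrable_mul hv

/-- The pairing of a mode function with a wave function. -/
def pairing (w c : ℝ → ℂ) : ℂ := ∫ k, c k * w k ∂modeMeasure

/-- The pairing of the reflected conjugate of a mode function with a wave function. -/
def coPairing (w c : ℝ → ℂ) : ℂ := ∫ k, conj (c (-k)) * w k ∂modeMeasure

section

variable {w : ℝ → ℂ} (hw : MemLp w 2 modeMeasure)
  (hn : ∫ k, conj (w k) * w k ∂modeMeasure = 1) {c d : ℝ → ℂ}
include hw hn

lemma integrable_and_integral_lin {f : ℝ → ℂ} (hf : MemLp f 2 modeMeasure) (x y : ℂ) :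
    Integrable (fun k => conj (w k) * (f k * x + y * w k)) modeMeasure ∧
      ∫ k, conj (w k) * (f k * x + y * w k) ∂modeMeasure =
        (∫ k, conj (w k) * f k ∂modeMeasure) * x + y := by
  have h : ∀ k, conj (w k) * (f k * x + y * w k) =
      conj (w k) * f k * x + y * (conj (w k) * w k) := fun k => by ring
  simp_rw [h]
  have h1 := (integrable_conj_mul hw hf).mul_const x
  have h2 := (integrable_conj_mul hw hw).const_mul y
  exact ⟨h1.add h2, by rw [integral_add h1 h2, integral_mul_const, integral_const_mul, hn, mul_one]⟩

/-- The vacuum term enters with coefficient one because `w` is normalized. -/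
lemma hasMean_part_fieldAdj_field (hc : IsMode c) :
    HasMean partAmp w (particle w) (fieldAdj c ∘ field d)
      (conj (pairing w c) * pairing w d + ∫ k, conj (c (-k)) * d (-k) ∂modeMeasure) := by
  have h := integrable_and_integral_lin hw hn hc.1.star (pairing w d)
    (∫ k, conj (c (-k)) * d (-k) ∂modeMeasure)
  have h' : conj (pairing w c) = ∫ k, conj (w k) * conj (c k) ∂modeMeasure := by
    simp only [pairing, ← integral_conj, map_mul, mul_comm]
  unfold HasMean
  simp only [Function.comp_apply, partAmp_fieldAdj_field, h']
  exact h

lemma hasMean_part_field_fieldAdj (hc : IsMode c) (hd : IsMode d) :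
    HasMean partAmp w (particle w) (field d ∘ fieldAdj c)
      (conj (pairing w c) * pairing w d + ∫ k, conj (c k) * d k ∂modeMeasure) := by
  have h := integrable_and_integral_lin hw hn hc.1.star (pairing w d)
    (∫ k, conj (c k) * d k ∂modeMeasure)
  have h' : conj (pairing w c) = ∫ k, conj (w k) * conj (c k) ∂modeMeasure := by
    simp only [pairing, ← integral_conj, map_mul, mul_comm]
  unfold HasMean
  simp only [Function.comp_apply, partAmp_field_fieldAdj w c d _
    (integrable_mul_conj hd.1 hc.1) (hd.1.integrable_mul hw), h']
  exact h

lemma hasMean_anti_fieldAdj_field (hc : IsMode c) (hd : IsMode d) :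
    HasMean antiAmp w (antiparticle w) (fieldAdj c ∘ field d)
      (conj (coPairing w d) * coPairing w c + ∫ k, conj (c (-k)) * d (-k) ∂modeMeasure) := by
  have h := integrable_and_integral_lin hw hn hd.2 (coPairing w c)
    (∫ k, conj (c (-k)) * d (-k) ∂modeMeasure)
  have h' : conj (coPairing w d) = ∫ k, conj (w k) * d (-k) ∂modeMeasure := by
    simp only [coPairing, ← integral_conj, map_mul, mul_comm, conj_conj]
  unfold HasMean
  simp only [Function.comp_apply, antiAmp_fieldAdj_field w c d _
    (integrable_conj_mul hc.2 hd.2) (hc.2.star.integrable_mul hw), h']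
  exact h

lemma hasMean_anti_field_fieldAdj (hd : IsMode d) :
    HasMean antiAmp w (antiparticle w) (field d ∘ fieldAdj c)
      (conj (coPairing w d) * coPairing w c + ∫ k, conj (c k) * d k ∂modeMeasure) := by
  have h := integrable_and_integral_lin hw hn hd.2 (coPairing w c)
    (∫ k, conj (c k) * d k ∂modeMeasure)
  have h' : conj (coPairing w d) = ∫ k, conj (w k) * d (-k) ∂modeMeasure := by
    simp only [coPairing, ← integral_conj, map_mul, mul_comm, conj_conj]
  unfold HasMean
  simp only [Function.comp_apply, antiAmp_field_fieldAdj w c d, h']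
  exact h

end

/-- The current of a one-particle wave function with value `a` and derivative `b`. -/
def currentForm (a b : ℂ) : ℂ := I * (conj a * b - conj b * a)

/-- The abstract `T` covers both kinds of state. The point is the shape of the last summand: after
the reflection rules `hc`, `hd` it is invariant under exchanging the `c` modes with the `d` modes.
The symmetrized products, with their factor `1/2`, are what make its mixed terms symmetric. -/
lemma hasMean_normalProduct {amp : FockVec → ℝ → ℂ} {w : ℝ → ℂ} {Ψ : FockVec}
    (hl : IsLinearAmp amp) {T : (ℝ → ℂ) → (ℝ → ℂ) → ℂ}
    (h1 : ∀ c d, IsMode c → IsMode d → HasMean amp w Ψ (fieldAdj c ∘ field d)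
      (T c d + ∫ k, conj (c (-k)) * d (-k) ∂modeMeasure))
    (h2 : ∀ c d, IsMode c → IsMode d → HasMean amp w Ψ (field d ∘ fieldAdj c)
      (T c d + ∫ k, conj (c k) * d k ∂modeMeasure))
    {cp cm dp dm : ℝ → ℂ} (hcp : IsMode cp) (hcm : IsMode cm) (hdp : IsMode dp)
    (hdm : IsMode dm) (hc : ∀ k, cp (-k) = conj (cm k)) (hd : ∀ k, dp (-k) = conj (dm k)) :
    HasMean amp w Ψ (normalProduct (fieldAdj cp) (fieldAdj cm) (field dm) (field dp))
      (T cp dp + T cm dm + T cp dm + T cm dp +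
        ((∫ k, cm k * conj (dm k) ∂modeMeasure) + (∫ k, conj (cm k) * dm k ∂modeMeasure) +
        (1 / 2) * ((∫ k, cm k * conj (dp k) ∂modeMeasure) + (∫ k, conj (cp k) * dm k ∂modeMeasure)
          + (∫ k, cp k * conj (dm k) ∂modeMeasure) +
          (∫ k, conj (cm k) * dp k ∂modeMeasure)))) := by
  have hc' : ∀ k, cm (-k) = conj (cp k) := fun k => by simpa using (congrArg conj (hc (-k))).symm
  have hd' : ∀ k, dm (-k) = conj (dp k) := fun k => by simpa using (congrArg conj (hd (-k))).symm
  have key := (((h1 cp dp hcp hdp).add hl (h2 cm dm hcm hdm)).add hl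
    (((h1 cp dm hcp hdm).add hl (h2 cp dm hcp hdm)).smul hl (1 / 2))).add hl
    (((h1 cm dp hcm hdp).add hl (h2 cm dp hcm hdp)).smul hl (1 / 2))
  simp only [hc, hd, hc', hd', conj_conj] at key
  unfold normalProduct
  convert key using 1
  ring

/-- The mean value of a normal-ordered current, when the operators are related by charge
conjugation: the vacuum contributions cancel. -/
lemma hasMean_normalCurrent {amp : FockVec → ℝ → ℂ} {w : ℝ → ℂ} {Ψ : FockVec}
    (hl : IsLinearAmp amp) {T : (ℝ → ℂ) → (ℝ → ℂ) → ℂ}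
    (h1 : ∀ c d, IsMode c → IsMode d → HasMean amp w Ψ (fieldAdj c ∘ field d)
      (T c d + ∫ k, conj (c (-k)) * d (-k) ∂modeMeasure))
    (h2 : ∀ c d, IsMode c → IsMode d → HasMean amp w Ψ (field d ∘ fieldAdj c)
      (T c d + ∫ k, conj (c k) * d k ∂modeMeasure))
    {cp cm : ℝ → ℝ → ℂ} {dp dm : ℝ → ℂ} {y : ℝ}
    (hp : (fun k => deriv (fun z => cp z k) y) = dp)
    (hm : (fun k => deriv (fun z => cm z k) y) = dm) (hcp : IsMode (cp y)) (hcm : IsMode (cm y))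
    (hdp : IsMode dp) (hdm : IsMode dm) (hc : ∀ k, cp y (-k) = conj (cm y k))
    (hd : ∀ k, dp (-k) = conj (dm k)) :
    HasMean amp w Ψ (normalCurrent cp cm y)
      (I * ((T (cp y) dp + T (cm y) dm + T (cp y) dm + T (cm y) dp) -
        (T dp (cp y) + T dm (cm y) + T dm (cp y) + T dp (cm y)))) := by
  have key := ((hasMean_normalProduct hl h1 h2 hcp hcm hdp hdm hc hd).sub hl
    (hasMean_normalProduct hl h1 h2 hdp hdm hcp hcm hd hc)).smul hl I
  unfold normalCurrent
  simp only [hp, hm]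
  convert key using 1
  simp only [mul_comm (conj _) _]
  ring

section

variable {w : ℝ → ℂ} (hw : MemLp w 2 modeMeasure)
  (hn : ∫ k, conj (w k) * w k ∂modeMeasure = 1) {cp cm : ℝ → ℝ → ℂ} {dp dm : ℝ → ℂ} {y : ℝ}
  (hp : (fun k => deriv (fun z => cp z k) y) = dp)
  (hm : (fun k => deriv (fun z => cm z k) y) = dm) (hcp : IsMode (cp y)) (hcm : IsMode (cm y))
  (hdp : IsMode dp) (hdm : IsMode dm) (hc : ∀ k, cp y (-k) = conj (cm y k))
  (hd : ∀ k, dp (-k) = conj (dm k))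
include hw hn hp hm hcp hcm hdp hdm hc hd

lemma mean_particle_normalCurrent :
    mean (particle w) (normalCurrent cp cm y) =
      currentForm (pairing w (cp y) + pairing w (cm y)) (pairing w dp + pairing w dm) := by
  rw [mean, fockInner_particle]
  refine (hasMean_normalCurrent isLinearAmp_partAmp
    (T := fun c d => conj (pairing w c) * pairing w d)
    (fun c d hc _ => hasMean_part_fieldAdj_field hw hn hc)
    (fun c d hc hd => hasMean_part_field_fieldAdj hw hn hc hd)
    hp hm hcp hcm hdp hdm hc hd).2.trans ?_
  simp only [currentForm, map_add]
  ring

/-- Charge conjugation exchanges the pairings of `cp` and `cm`, so the same total amplitudes appear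
as for the particle, with field and derivative interchanged. -/
lemma mean_antiparticle_normalCurrent :
    mean (antiparticle w) (normalCurrent cp cm y) =
      -currentForm (pairing w (cp y) + pairing w (cm y)) (pairing w dp + pairing w dm) := by
  have hc' : ∀ k, cm y (-k) = conj (cp y k) := fun k => by
    simpa using (congrArg conj (hc (-k))).symm
  have hd' : ∀ k, dm (-k) = conj (dp k) := fun k => by simpa using (congrArg conj (hd (-k))).symm
  rw [mean, fockInner_antiparticle]
  refine (hasMean_normalCurrent isLinearAmp_antiAmp
    (T := fun c d => conj (coPairing w d) * coPairing w c)
    (fun c d hc hd => hasMean_anti_fieldAdj_field hw hn hc hd)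
    (fun c d hc hd => hasMean_anti_field_fieldAdj hw hn hd)
    hp hm hcp hcm hdp hdm hc hd).2.trans ?_
  have e1 : coPairing w (cp y) = pairing w (cm y) := by simp [coPairing, pairing, hc]
  have e2 : coPairing w (cm y) = pairing w (cp y) := by simp [coPairing, pairing, hc']
  have e3 : coPairing w dp = pairing w dm := by simp [coPairing, pairing, hd]
  have e4 : coPairing w dm = pairing w dp := by simp [coPairing, pairing, hd']
  simp only [currentForm, map_add, e1, e2, e3, e4]
  ring

end

section

variable {X : ℝ → ℝ} {η ε y : ℝ} {c d : ℝ → ℂ} (hc : inMode η (X (y + ε)) = c)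
  (hd : (fun k => deriv (fun z => inMode η (X z) k) y) = d)
include hc hd

lemma mean_vacuum_splitCurrent :
    mean vacuum (splitCurrent X η ε y) = I * ((∫ k, conj (c (-k)) * d (-k) ∂modeMeasure) -
      ∫ k, conj (d (-k)) * c (-k) ∂modeMeasure) := by
  rw [mean, fockInner_vacuum, ← vacAmp_fieldAdj_field, ← vacAmp_fieldAdj_field]
  unfold splitCurrent
  rw [hc, hd]
  rfl

variable {w : ℝ → ℂ} (hw : MemLp w 2 modeMeasure)
  (hn : ∫ k, conj (w k) * w k ∂modeMeasure = 1) (hcm : IsMode c) (hdm : IsMode d)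
include hw hn hcm hdm

lemma mean_particle_splitCurrent :
    mean (particle w) (splitCurrent X η ε y) =
      currentForm (pairing w c) (pairing w d) + mean vacuum (splitCurrent X η ε y) := by
  rw [mean_vacuum_splitCurrent hc hd, mean, fockInner_particle]
  unfold splitCurrent
  rw [hc, hd]
  refine (((hasMean_part_fieldAdj_field hw hn hcm).sub isLinearAmp_partAmp
    (hasMean_part_fieldAdj_field hw hn hdm)).smul isLinearAmp_partAmp I).2.trans ?_
  simp only [currentForm]
  ring

lemma mean_antiparticle_splitCurrent (hcc : ∀ k, c (-k) = conj (c k))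
    (hdd : ∀ k, d (-k) = conj (d k)) :
    mean (antiparticle w) (splitCurrent X η ε y) =
      -currentForm (pairing w c) (pairing w d) + mean vacuum (splitCurrent X η ε y) := by
  rw [mean_vacuum_splitCurrent hc hd, mean, fockInner_antiparticle]
  unfold splitCurrent
  rw [hc, hd]
  refine (((hasMean_anti_fieldAdj_field hw hn hcm hdm).sub isLinearAmp_antiAmp
    (hasMean_anti_fieldAdj_field hw hn hdm hcm)).smul isLinearAmp_antiAmp I).2.trans ?_
  have e1 : coPairing w c = pairing w c := by simp [coPairing, pairing, hcc]
  have e2 : coPairing w d = pairing w d := by simp [coPairing, pairing, hdd]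
  simp only [currentForm, e1, e2]
  ring

end

/-! ### Integration with respect to `dk / 2k` -/

lemma measurable_modeDensity : Measurable fun k : ℝ => ENNReal.ofReal (1 / (2 * k)) := by
  fun_prop

lemma integrable_modeMeasure_iff {f : ℝ → ℂ} :
    Integrable f modeMeasure ↔
      IntegrableOn (fun k : ℝ => (1 / (2 * k) : ℂ) * f k) (Set.Ioi 0) := by
  unfold modeMeasure
  rw [integrable_withDensity_iff_integrable_smul' measurable_modeDensity (by simp), IntegrableOn]
  refine integrable_congr ((ae_restrict_iff' measurableSet_Ioi).2 (ae_of_all _ fun k hk => ?_))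
  have hk : (0 : ℝ) < k := hk
  simp only
  rw [ENNReal.toReal_ofReal (by positivity), real_smul]
  push_cast
  rfl

lemma integral_modeMeasure (f : ℝ → ℂ) :
    ∫ k, f k ∂modeMeasure = ∫ k in Set.Ioi (0 : ℝ), (1 / (2 * k) : ℂ) * f k := by
  unfold modeMeasure
  rw [integral_withDensity_eq_integral_toReal_smul measurable_modeDensity (by simp)]
  refine setIntegral_congr_fun measurableSet_Ioi fun k hk => ?_
  have hk : (0 : ℝ) < k := hk
  rw [ENNReal.toReal_ofReal (by positivity), real_smul]
  push_cast
  rfl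

lemma ae_modeMeasure_pos : ∀ᵐ k ∂modeMeasure, (0 : ℝ) < k :=
  (withDensity_absolutelyContinuous _ _).ae_le
    ((ae_restrict_iff' measurableSet_Ioi).2 (ae_of_all _ fun _ hk => hk))

/-- The factor `2 * k` in the bound absorbs the density `1/(2k)`, so Lebesgue integrability of `B`
is enough. -/
lemma integrable_modeMeasure_of_bound {f : ℝ → ℂ} (hf : Measurable f) {B : ℝ → ℝ}
    (hB : IntegrableOn B (Set.Ioi 0)) (h : ∀ k : ℝ, 0 < k → ‖f k‖ ≤ 2 * k * B k) :
    Integrable f modeMeasure := by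
  rw [integrable_modeMeasure_iff]
  refine Integrable.mono' hB (by fun_prop)
    ((ae_restrict_iff' measurableSet_Ioi).2 (ae_of_all _ fun k hk => ?_))
  have hk : (0 : ℝ) < k := hk
  have h2 : ‖(1 / (2 * k) : ℂ)‖ = 1 / (2 * k) := by
    simp [abs_of_pos hk]
  rw [norm_mul, h2, div_mul_eq_mul_div, one_mul, div_le_iff₀ (by positivity)]
  linarith [h k hk]

/-! ### Cut-off modes -/

lemma cutoff_nonneg (η k : ℝ) : 0 ≤ cutoff η k := by
  unfold cutoff
  split_ifs <;> positivity

lemma cutoff_le_one {η : ℝ} (hη : 0 < η) (k : ℝ) : cutoff η k ≤ 1 := by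
  unfold cutoff
  split_ifs
  · exact Real.exp_le_one_iff.2 (by have := abs_nonneg k; nlinarith)
  · exact zero_le_one

lemma cutoff_neg (η k : ℝ) : cutoff η (-k) = cutoff η k := by
  simp [cutoff]

lemma measurable_cutoff (η : ℝ) : Measurable (cutoff η) := by
  unfold cutoff
  exact Measurable.ite (measurableSet_lt measurable_const (by fun_prop)) (by fun_prop)
    measurable_const

lemma tendsto_cutoff {k : ℝ} (hk : 0 < k) :
    Tendsto (fun η => cutoff η k) (𝓝[>] 0) (𝓝 1) := by
  have h : Tendsto (fun η : ℝ => Real.exp (-(η * |k|))) (𝓝[>] 0) (𝓝 1) := by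
    have : Tendsto (fun η : ℝ => Real.exp (-(η * |k|))) (𝓝 0) (𝓝 (Real.exp (-(0 * |k|)))) :=
      Continuous.tendsto (by fun_prop) 0
    simpa using this.mono_left nhdsWithin_le_nhds
  refine h.congr' ?_
  have : ∀ᶠ η in 𝓝[>] (0 : ℝ), η < |k| :=
    nhdsWithin_le_nhds (Iio_mem_nhds (abs_pos.2 hk.ne'))
  filter_upwards [this] with η h1
  simp [cutoff, h1]

/-- The infrared cut-off removes the singularity of `dk/(2k)`, and the exponential damping beats any
polynomial growth. -/
lemma memLp_two_of_cutoff_bound {f : ℝ → ℂ} (hf : Measurable f) {η C : ℝ} (hη : 0 < η) {N : ℕ}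
    (h : ∀ k, ‖f k‖ ≤ C * (1 + |k|) ^ N * cutoff η k) : MemLp f 2 modeMeasure := by
  rw [memLp_two_iff_integrable_sq_norm hf.aestronglyMeasurable]
  suffices hs : Integrable (fun k => ((‖f k‖ ^ 2 : ℝ) : ℂ)) modeMeasure from hs.re
  have hfac : (0 : ℝ) < (2 * N).factorial := by positivity
  -- The square of the damping is `exp (-2ηk)`. One factor `exp (-ηk)` pays for `(1 + k) ^ (2N)`
  -- through `t ^ m / m! ≤ exp t` at `t = η (1 + k)`; the other remains as majorant. The division by
  -- `2η` uses `η < k`.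
  set D : ℝ := C ^ 2 * ((2 * N).factorial / η ^ (2 * N) * Real.exp η) / (2 * η) with hD
  refine integrable_modeMeasure_of_bound (by fun_prop) (B := fun k => D * Real.exp (-η * k))
    ((integrableOn_exp_mul_Ioi (neg_neg_of_pos hη) 0).const_mul D) fun k hk => ?_
  rw [norm_real, Real.norm_of_nonneg (by positivity)]
  by_cases hkη : η < k
  · have hc : cutoff η k = Real.exp (-(η * k)) := by simp [cutoff, abs_of_pos hk, hkη]
    have h1 := h k
    rw [hc, abs_of_pos hk] at h1
    have h2 : (1 + k) ^ (2 * N) ≤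
        (2 * N).factorial / η ^ (2 * N) * (Real.exp η * Real.exp (η * k)) := by
      have := Real.pow_div_factorial_le_exp (η * (1 + k)) (by positivity) (2 * N)
      rw [div_le_iff₀ hfac, mul_pow, mul_add, mul_one, Real.exp_add] at this
      rw [div_mul_eq_mul_div, le_div_iff₀ (by positivity)]
      linarith
    calc ‖f k‖ ^ 2 ≤ (C * (1 + k) ^ N * Real.exp (-(η * k))) ^ 2 :=
          pow_le_pow_left₀ (norm_nonneg _) h1 2
      _ = C ^ 2 * (1 + k) ^ (2 * N) * (Real.exp (-(η * k)) * Real.exp (-(η * k))) := by ring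
      _ ≤ C ^ 2 * ((2 * N).factorial / η ^ (2 * N) * (Real.exp η * Real.exp (η * k))) *
          (Real.exp (-(η * k)) * Real.exp (-(η * k))) := by gcongr
      _ = C ^ 2 * ((2 * N).factorial / η ^ (2 * N) * Real.exp η) *
          (Real.exp (η * k) * Real.exp (-(η * k))) * Real.exp (-(η * k)) := by ring
      _ = (2 * η) * (D * Real.exp (-η * k)) := by
          rw [← Real.exp_add, add_neg_cancel, Real.exp_zero, hD, neg_mul]
          field_simp
      _ ≤ 2 * k * (D * Real.exp (-η * k)) := by
          have : 0 ≤ D := by positivity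
          gcongr
  · have hc : cutoff η k = 0 := by simp [cutoff, abs_of_pos hk, hkη]
    have h1 := h k
    rw [hc, mul_zero] at h1
    have : ‖f k‖ = 0 := le_antisymm h1 (norm_nonneg _)
    rw [this, zero_pow two_ne_zero]
    have : 0 ≤ D := by positivity
    positivity

lemma isMode_of_cutoff_bound {f : ℝ → ℂ} (hf : Measurable f) {η C : ℝ} (hη : 0 < η) {N : ℕ}
    (h : ∀ k, ‖f k‖ ≤ C * (1 + |k|) ^ N * cutoff η k) : IsMode f :=
  ⟨memLp_two_of_cutoff_bound hf hη h,
    memLp_two_of_cutoff_bound (hf.comp measurable_neg) hη fun k => by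
      simpa [cutoff_neg] using h (-k)⟩

lemma measurable_inMode (η x : ℝ) : Measurable (inMode η x) := by
  have := measurable_cutoff η
  unfold inMode
  fun_prop

lemma norm_exp_phase (k x : ℝ) : ‖exp (-(I * k * x))‖ = 1 := by
  rw [show -(I * k * x : ℂ) = ((-(k * x) : ℝ) : ℂ) * I by push_cast; ring]
  exact norm_exp_ofReal_mul_I _

lemma norm_inMode (η x k : ℝ) : ‖inMode η x k‖ = cutoff η k / Real.sqrt (2 * Real.pi) := by
  unfold inMode
  rw [norm_div, norm_mul, norm_exp_phase, mul_one, norm_real, norm_real, Real.norm_of_nonneg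
    (cutoff_nonneg η k), Real.norm_of_nonneg (Real.sqrt_nonneg _)]

lemma inMode_neg (η x k : ℝ) : inMode η x (-k) = conj (inMode η x k) := by
  simp only [inMode, cutoff_neg, map_div₀, map_mul, conj_ofReal, ← exp_conj]
  simp

lemma hasDerivAt_inMode (η k : ℝ) {X : ℝ → ℝ} {X' y : ℝ} (hX : HasDerivAt X X' y) :
    HasDerivAt (fun z => inMode η (X z) k) (-(I * k * X') * inMode η (X y) k) y := by
  have h := (((((hX.ofReal_comp).const_mul (I * k)).neg.cexp).const_mul
    (cutoff η k : ℂ)).div_const (Real.sqrt (2 * Real.pi) : ℂ))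
  refine h.congr_deriv ?_
  simp only [inMode, Pi.neg_apply]
  ring

lemma norm_inMode_le (η x k : ℝ) :
    ‖inMode η x k‖ ≤ 1 / Real.sqrt (2 * Real.pi) * (1 + |k|) ^ 0 * cutoff η k := by
  rw [norm_inMode, pow_zero]
  exact le_of_eq (by ring)

lemma norm_mul_inMode_le (η x X' k : ℝ) :
    ‖-(I * k * X') * inMode η x k‖ ≤
      |X'| / Real.sqrt (2 * Real.pi) * (1 + |k|) ^ 1 * cutoff η k := by
  rw [norm_mul, norm_inMode, norm_neg, norm_mul, norm_mul, norm_I, norm_real, norm_real, one_mul,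
    pow_one, Real.norm_eq_abs, Real.norm_eq_abs]
  have := cutoff_nonneg η k
  calc |k| * |X'| * (cutoff η k / √(2 * Real.pi))
      = |X'| / √(2 * Real.pi) * |k| * cutoff η k := by ring
    _ ≤ _ := by gcongr; linarith

lemma isMode_inMode {η : ℝ} (hη : 0 < η) (x : ℝ) : IsMode (inMode η x) :=
  isMode_of_cutoff_bound (measurable_inMode η x) hη (norm_inMode_le η x)

lemma isMode_mul_inMode {η : ℝ} (hη : 0 < η) (x X' : ℝ) :
    IsMode fun k => -(I * k * X') * inMode η x k :=
  isMode_of_cutoff_bound (by have := measurable_inMode η x; fun_prop) hη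
    (norm_mul_inMode_le η x X')

/-! ### The point-split current in the vacuum -/

/-- The factor `k` of the differentiated mode cancels `1/(2k)`, and the squared cut-off leaves an
elementary exponential integral over `(η, ∞)`. -/
lemma integral_cutoff_sq_exp {η : ℝ} (hη : 0 < η) (Δ : ℝ) :
    ∫ k, (k : ℂ) * (cutoff η k : ℂ) ^ 2 * exp (-(I * k * Δ)) ∂modeMeasure =
      exp (-(2 * η + I * Δ) * η) / (2 * (2 * η + I * Δ)) := by
  have hre : (-(2 * η + I * Δ : ℂ)).re < 0 := by simp [hη]
  have h : ∀ k ∈ Set.Ioi (0 : ℝ),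
      (1 / (2 * k) : ℂ) * ((k : ℂ) * (cutoff η k : ℂ) ^ 2 * exp (-(I * k * Δ))) =
      (Set.Ioi η).indicator (fun k : ℝ => (1 / 2 : ℂ) * exp (-(2 * η + I * Δ) * k)) k := by
    intro k hk
    have hk : (0 : ℝ) < k := hk
    have hk' : (k : ℂ) ≠ 0 := by exact_mod_cast hk.ne'
    by_cases hkη : η < k
    · rw [Set.indicator_of_mem (show k ∈ Set.Ioi η from hkη)]
      simp only [cutoff, abs_of_pos hk, hkη, if_true, ofReal_exp]
      rw [← exp_nat_mul, mul_assoc, ← exp_add, ← mul_assoc]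
      congr 1
      · field_simp
      · congr 1
        push_cast
        ring
    · rw [Set.indicator_of_notMem (show k ∉ Set.Ioi η from hkη)]
      simp [cutoff, abs_of_pos hk, hkη]
  rw [integral_modeMeasure, setIntegral_congr_fun measurableSet_Ioi h,
    setIntegral_indicator measurableSet_Ioi, Set.Ioi_inter_Ioi, max_eq_right hη.le,
    integral_const_mul, integral_exp_mul_complex_Ioi hre]
  have h0 : (2 * η + I * Δ : ℂ) ≠ 0 := by
    intro h0
    rw [h0] at hre
    simp at hre
  field_simp

lemma tendsto_integral_cutoff_sq_exp {Δ : ℝ} (hΔ : Δ ≠ 0) :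
    Tendsto (fun η : ℝ => ∫ k, (k : ℂ) * (cutoff η k : ℂ) ^ 2 * exp (-(I * k * Δ)) ∂modeMeasure)
      (𝓝[>] 0) (𝓝 (1 / (2 * (I * Δ)))) := by
  have hΔ' : (I * Δ : ℂ) ≠ 0 := mul_ne_zero I_ne_zero (by exact_mod_cast hΔ)
  have h : ContinuousAt (fun η : ℝ => exp (-(2 * η + I * Δ) * η) / (2 * (2 * η + I * Δ))) 0 := by
    refine ContinuousAt.div (by fun_prop) (by fun_prop) ?_
    simpa using hΔ
  have h := h.tendsto
  simp only [ofReal_zero, mul_zero, exp_zero, zero_add] at h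
  refine (h.mono_left nhdsWithin_le_nhds).congr' ?_
  filter_upwards [self_mem_nhdsWithin] with η hη
  exact (integral_cutoff_sq_exp hη Δ).symm

lemma hasSplitMean_vacuum {X : ℝ → ℝ} {ε y : ℝ} (hX : DifferentiableAt ℝ X y)
    (hne : X (y + ε) ≠ X y) : HasSplitMean X vacuum ε y 0 := by
  set Δ := X (y + ε) - X y with hΔ
  have hΔ0 : Δ ≠ 0 := sub_ne_zero.2 hne
  have h1 := tendsto_integral_cutoff_sq_exp hΔ0
  have h2 := tendsto_integral_cutoff_sq_exp (neg_ne_zero.2 hΔ0)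
  have h3 := (h1.add h2).const_mul (I * (I * ((deriv X y : ℝ) : ℂ) / (2 * Real.pi)))
  -- The two halves of the split current see the separations `Δ` and `-Δ`, and the limiting
  -- two-point function is odd.
  have h0 : (1 / (2 * (I * Δ)) : ℂ) + 1 / (2 * (I * ((-Δ : ℝ) : ℂ))) = 0 := by
    push_cast
    rw [mul_neg, mul_neg, div_neg, add_neg_cancel]
  rw [h0, mul_zero] at h3
  refine h3.congr' ?_
  filter_upwards [self_mem_nhdsWithin] with η hη
  have hη : 0 < η := hη
  have hd : (fun k => deriv (fun z => inMode η (X z) k) y) =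
      fun k : ℝ => -(I * k * (deriv X y : ℝ)) * inMode η (X y) k := by
    funext k
    exact (hasDerivAt_inMode η k hX.hasDerivAt).deriv
  rw [mean_vacuum_splitCurrent rfl hd, mul_assoc]
  congr 1
  have hpi : ((Real.sqrt (2 * Real.pi) : ℝ) : ℂ) * (Real.sqrt (2 * Real.pi) : ℝ) =
      2 * Real.pi := by
    rw [← ofReal_mul, Real.mul_self_sqrt (by positivity)]
    push_cast
    ring
  have hpi0 : ((Real.sqrt (2 * Real.pi) : ℝ) : ℂ) ≠ 0 := by
    norm_cast
    positivity
  rw [mul_add, sub_eq_add_neg, ← integral_neg, ← integral_const_mul, ← integral_const_mul]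
  congr 1
  all_goals
    congr 1
    funext k
    simp only [inMode_neg, map_mul, map_neg, conj_conj, conj_I, conj_ofReal, ofReal_neg]
    simp only [inMode, map_div₀, map_mul, conj_ofReal, ← exp_conj, map_neg, conj_I]
    rw [← hpi, hΔ]
    push_cast
  · rw [show -(I * (k : ℂ) * (X (y + ε) - X y)) =
      -(I * k * X (y + ε)) + -(-I * k * X y) by ring, exp_add]
    field_simp
  · rw [show -(I * (k : ℂ) * -(X (y + ε) - X y)) =
      -(-I * k * X (y + ε)) + -(I * k * X y) by ring, exp_add]
    field_simp

lemma integrable_conj {μ : Measure ℝ} {f : ℝ → ℂ} (h : Integrable f μ) :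
    Integrable (fun x => conj (f x)) μ :=
  memLp_one_iff_integrable.1 (memLp_one_iff_integrable.2 h).star

/-! ### The Fourier transform -/

lemma ft_eq_fourier (f : ℝ → ℂ) (k : ℝ) :
    ft f k = (1 / (Real.sqrt (2 * Real.pi) : ℂ)) * 𝓕 f (k / (2 * Real.pi)) := by
  rw [ft, Real.fourier_real_eq_integral_exp_smul]
  congr 2
  funext x
  rw [smul_eq_mul]
  congr 2
  push_cast
  have : (Real.pi : ℂ) ≠ 0 := by exact_mod_cast Real.pi_ne_zero
  field_simp

lemma sqrt_two_pi_ne_zero : ((Real.sqrt (2 * Real.pi) : ℝ) : ℂ) ≠ 0 := by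
  norm_cast
  positivity

lemma sqrt_two_pi_mul_self : ((Real.sqrt (2 * Real.pi) : ℝ) : ℂ) * (Real.sqrt (2 * Real.pi) : ℝ) =
    2 * Real.pi := by
  rw [← ofReal_mul, Real.mul_self_sqrt (by positivity)]
  push_cast
  ring

/-- This is the standard inversion theorem, rescaled by `ξ = k / (2π)`. -/
lemma ft_inversion {f : ℝ → ℂ} (hc : Continuous f) (hi : Integrable f) (hft : Integrable (ft f))
    (x : ℝ) :
    (1 / (Real.sqrt (2 * Real.pi) : ℂ)) * ∫ k : ℝ, exp (I * k * x) * ft f k = f x := by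
  have h2pi : (2 * Real.pi : ℝ) ≠ 0 := by positivity
  have h0 := sqrt_two_pi_ne_zero
  have hF : ∀ ξ, 𝓕 f ξ = (Real.sqrt (2 * Real.pi) : ℂ) * ft f (ξ * (2 * Real.pi)) := by
    intro ξ
    rw [ft_eq_fourier, mul_div_assoc, div_self h2pi, mul_one]
    field_simp
  have hFi : Integrable (𝓕 f) := by
    rw [funext hF]
    exact (hft.comp_mul_right' h2pi).const_mul _
  rw [← congrFun (hc.fourierInv_fourier_eq hi hFi) x,
    Real.fourierInv_eq_fourier_neg, Real.fourier_real_eq_integral_exp_smul]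
  have key := Measure.integral_comp_mul_right
    (fun k : ℝ => (Real.sqrt (2 * Real.pi) : ℂ) * (exp (I * k * x) * ft f k)) (2 * Real.pi)
  have h1 : ∀ v : ℝ, cexp (((-2 * Real.pi * v * -x : ℝ) : ℂ) * I) • 𝓕 f v =
      (Real.sqrt (2 * Real.pi) : ℂ) * (exp (I * (v * (2 * Real.pi) : ℝ) * x) *
        ft f (v * (2 * Real.pi))) := by
    intro v
    rw [hF, smul_eq_mul]
    push_cast
    rw [show -2 * (Real.pi : ℂ) * v * -x * I = I * (v * (2 * Real.pi)) * x by ring]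
    ring
  simp_rw [h1]
  rw [key, integral_const_mul, abs_of_pos (by positivity), real_smul, ← mul_assoc]
  congr 1
  push_cast
  rw [← sqrt_two_pi_mul_self]
  field_simp

lemma exists_schwartz_ft (g : 𝓢(ℝ, ℂ)) : ∃ h : 𝓢(ℝ, ℂ), ∀ k, h k = ft g k := by
  have h2pi : (2 * Real.pi : ℝ)⁻¹ ≠ 0 := by positivity
  refine ⟨(1 / (Real.sqrt (2 * Real.pi) : ℂ)) • SchwartzMap.compCLMOfContinuousLinearEquiv ℂ
    (ContinuousLinearEquiv.unitsEquivAut ℝ (Units.mk0 _ h2pi)) (𝓕 g), fun k => ?_⟩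
  rw [ft_eq_fourier, ← SchwartzMap.fourier_coe]
  simp [div_eq_mul_inv]

/-- Wave functions which decay fast at infinity and are integrable with respect to `dk / 2k`. -/
structure IsWave (w : ℝ → ℂ) : Prop where
  measurable : Measurable w
  integrable_pow : ∀ N : ℕ, Integrable (fun k => (((1 + |k|) ^ N : ℝ) : ℂ) * w k) modeMeasure
  memLp : MemLp w 2 modeMeasure

/-- Vanishing at the origin gives `‖h k‖ ≤ C |k|`, which compensates the weight `1/(2k)`.
Boundedness together with integrability then gives square integrability. -/
lemma isWave_of_schwartz (h : 𝓢(ℝ, ℂ)) (h0 : h 0 = 0) : IsWave h := by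
  have hlip : ∃ C, 0 ≤ C ∧ ∀ k, ‖h k‖ ≤ C * |k| := by
    obtain ⟨C, hC, hC'⟩ := h.decay 0 1
    refine ⟨C, hC.le, fun k => ?_⟩
    have := Convex.norm_image_sub_le_of_norm_fderiv_le (𝕜 := ℝ) (f := h) (C := C) (s := Set.univ)
      (x := 0) (y := k) (fun x _ => h.differentiableAt) (fun x _ => by
        have := hC' x
        rwa [pow_zero, one_mul, norm_iteratedFDeriv_one] at this) convex_univ trivial trivial
    simpa [h0] using this
  obtain ⟨C, hC, hlip⟩ := hlip
  have hm : Measurable h := h.continuous.measurable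
  have hpow : ∀ N : ℕ, Integrable (fun k => (((1 + |k|) ^ N : ℝ) : ℂ) * h k) modeMeasure := by
    intro N
    obtain ⟨D, hD, hD'⟩ := h.decay (N + 1) 0
    simp only [norm_iteratedFDeriv_zero] at hD'
    refine integrable_modeMeasure_of_bound (by fun_prop)
      (B := fun k => 2 ^ N * (C + D) * (1 + k ^ 2)⁻¹)
      (integrable_inv_one_add_sq.integrableOn.const_mul _) fun k hk => ?_
    have hk2 : (0 : ℝ) < 1 + k ^ 2 := by positivity
    rw [norm_mul, norm_real, Real.norm_of_nonneg (by positivity), abs_of_pos hk]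
    have hlip := hlip k
    have hD' := hD' k
    rw [Real.norm_of_nonneg hk.le] at hD'
    rw [abs_of_pos hk] at hlip
    rw [← mul_assoc, ← div_eq_mul_inv, le_div_iff₀ hk2]
    -- Below `1` the Lipschitz bound supplies the factor `k`; above `1` the decay of order `N + 1`
    -- is used.
    rcases le_total k 1 with h1 | h1
    · calc (1 + k) ^ N * ‖h k‖ * (1 + k ^ 2) ≤ 2 ^ N * (C * k) * 2 := by
            gcongr
            · linarith
            · nlinarith
        _ = 2 * k * (2 ^ N * C) := by ring
        _ ≤ 2 * k * (2 ^ N * (C + D)) := by gcongr; linarith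
    · calc (1 + k) ^ N * ‖h k‖ * (1 + k ^ 2) ≤ (2 * k) ^ N * ‖h k‖ * (2 * k ^ 2) := by
            gcongr
            · linarith
            · nlinarith
        _ = 2 * k * (2 ^ N * (k ^ (N + 1) * ‖h k‖)) := by ring
        _ ≤ 2 * k * (2 ^ N * (C + D)) := by gcongr; linarith
  refine ⟨hm, hpow, ?_⟩
  obtain ⟨B, hB, hB'⟩ := h.decay 0 0
  simp only [norm_iteratedFDeriv_zero, pow_zero, one_mul] at hB'
  rw [memLp_two_iff_integrable_sq_norm hm.aestronglyMeasurable]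
  have h1 := (hpow 0).norm.const_mul B
  refine h1.mono' (by fun_prop) (ae_of_all _ fun k => ?_)
  simp only [pow_zero, ofReal_one, one_mul]
  rw [Real.norm_of_nonneg (by positivity), sq]
  exact mul_le_mul_of_nonneg_right (hB' k) (norm_nonneg _)

/-! ### Waves -/

/-- The value at `x` of the wave with momentum space wave function `w`. -/
def wave (w : ℝ → ℂ) (x : ℝ) : ℂ :=
  (1 / (Real.sqrt (2 * Real.pi) : ℂ)) * ∫ k, exp (-(I * k * x)) * w k ∂modeMeasure

/-- The derivative of `wave`. -/
def waveDeriv (w : ℝ → ℂ) (x : ℝ) : ℂ :=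
  (1 / (Real.sqrt (2 * Real.pi) : ℂ)) * ∫ k, -(I * k) * exp (-(I * k * x)) * w k ∂modeMeasure

lemma norm_wave_le (w : ℝ → ℂ) (x : ℝ) :
    ‖wave w x‖ ≤ ‖(1 / (Real.sqrt (2 * Real.pi) : ℂ))‖ * ∫ k, ‖w k‖ ∂modeMeasure := by
  rw [wave, norm_mul]
  gcongr
  refine (norm_integral_le_integral_norm _).trans (le_of_eq ?_)
  simp only [norm_mul, norm_exp_phase, one_mul]

/-- The Riemann-Lebesgue lemma, applied to `w k / (2k)` extended by zero to the negative half-line.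
-/
lemma tendsto_wave_atBot (w : ℝ → ℂ) : Tendsto (wave w) atBot (𝓝 0) := by
  set f : ℝ → ℂ := (Set.Ioi (0 : ℝ)).indicator fun k => (1 / (2 * k) : ℂ) * w k with hf
  have h1 := (Real.tendsto_integral_exp_smul_cocompact f).mono_left atBot_le_cocompact
  have h2 : Tendsto (fun x : ℝ => x / (2 * Real.pi)) atBot atBot :=
    tendsto_id.atBot_div_const (by positivity)
  have h3 := (h1.comp h2).const_mul (1 / (Real.sqrt (2 * Real.pi) : ℂ))
  rw [mul_zero] at h3
  refine h3.congr fun x => ?_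
  rw [wave, integral_modeMeasure, ← integral_indicator measurableSet_Ioi]
  congr 1
  refine integral_congr_ae (ae_of_all _ fun k => ?_)
  simp only
  rw [Circle.smul_def, Real.fourierChar_apply, smul_eq_mul, hf]
  by_cases hk : k ∈ Set.Ioi (0 : ℝ)
  · simp only [Set.indicator_of_mem hk]
    have hpi : (Real.pi : ℂ) ≠ 0 := by exact_mod_cast Real.pi_ne_zero
    rw [show ((2 * Real.pi * -(k * (x / (2 * Real.pi))) : ℝ) : ℂ) * I = -(I * k * x) by
      push_cast
      field_simp]
    ring
  · simp only [Set.indicator_of_notMem hk, mul_zero]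

namespace IsWave

variable {w : ℝ → ℂ} (hw : IsWave w)
include hw

lemma star : IsWave fun k => conj (w k) where
  measurable := by have := hw.measurable; fun_prop
  integrable_pow N := by
    have h := integrable_conj (hw.integrable_pow N)
    simpa using h
  memLp := hw.memLp.star

lemma integrable : Integrable w modeMeasure := by
  simpa using hw.integrable_pow 0

lemma integrable_mul : Integrable (fun k : ℝ => (k : ℂ) * w k) modeMeasure := by
  refine (hw.integrable_pow 1).mono (by have := hw.measurable; fun_prop) (ae_of_all _ fun k => ?_)
  rw [norm_mul, norm_mul, norm_real, norm_real, Real.norm_eq_abs,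
    Real.norm_of_nonneg (by positivity), pow_one]
  gcongr
  linarith

lemma hasDerivAt_wave (x : ℝ) : HasDerivAt (wave w) (waveDeriv w x) x := by
  have hm := hw.measurable
  refine HasDerivAt.const_mul _ (hasDerivAt_integral_of_dominated_loc_of_deriv_le
    (F := fun (x k : ℝ) => exp (-(I * k * x)) * w k)
    (F' := fun (x k : ℝ) => -(I * k) * exp (-(I * k * x)) * w k)
    (bound := fun k : ℝ => ‖(k : ℂ) * w k‖) univ_mem
    (Eventually.of_forall fun _ => by fun_prop) ?_ (by fun_prop) ?_ hw.integrable_mul.norm ?_).2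
  · refine hw.integrable.mono (by fun_prop) (ae_of_all _ fun k => ?_)
    rw [norm_mul, norm_exp_phase, one_mul]
  · refine ae_of_all _ fun k x _ => ?_
    simp only [norm_mul, norm_exp_phase, norm_neg, norm_I, one_mul, mul_one, le_refl]
  · refine ae_of_all _ fun k x _ => ?_
    have h := ((((hasDerivAt_id x).ofReal_comp).const_mul (I * k)).neg.cexp).mul_const (w k)
    refine h.congr_deriv ?_
    simp only [Pi.neg_apply, id, ofReal_one]
    ring

lemma continuous_wave : Continuous (wave w) :=
  continuous_iff_continuousAt.2 fun x => (hw.hasDerivAt_wave x).continuousAt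

/-- The pairing with cut-off modes converges to the wave. -/
lemma tendsto_pairing_inMode (x : ℝ) :
    Tendsto (fun η => pairing w (inMode η x)) (𝓝[>] 0) (𝓝 (wave w x)) := by
  have hm := hw.measurable
  have hs := sqrt_two_pi_ne_zero
  rw [wave, ← integral_const_mul]
  refine tendsto_integral_filter_of_dominated_convergence
    (fun k => 1 / Real.sqrt (2 * Real.pi) * ‖w k‖) ?_ ?_ (hw.integrable.norm.const_mul _) ?_
  · refine Eventually.of_forall fun η => ?_
    have := measurable_inMode η x
    fun_prop
  · filter_upwards [self_mem_nhdsWithin] with η hη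
    refine ae_of_all _ fun k => ?_
    rw [norm_mul, norm_inMode]
    gcongr
    exact cutoff_le_one hη k
  · filter_upwards [ae_modeMeasure_pos] with k hk
    have h := ((continuous_ofReal.tendsto 1).comp (tendsto_cutoff hk)).mul_const
      (exp (-(I * k * x)) / (Real.sqrt (2 * Real.pi) : ℂ) * w k)
    convert h using 1
    · funext η
      simp only [inMode, Function.comp_apply]
      ring
    · rw [ofReal_one]
      congr 1
      ring

lemma tendsto_pairing_mul_inMode (x : ℝ) (X' : ℝ) :
    Tendsto (fun η => pairing w fun k => -(I * k * X') * inMode η x k) (𝓝[>] 0)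
      (𝓝 (X' * waveDeriv w x)) := by
  have hm := hw.measurable
  have hs := sqrt_two_pi_ne_zero
  rw [waveDeriv, ← mul_assoc, ← integral_const_mul]
  refine tendsto_integral_filter_of_dominated_convergence
    (fun k => |X'| * (1 / Real.sqrt (2 * Real.pi)) * ‖k * w k‖) ?_ ?_
    (hw.integrable_mul.norm.const_mul _) ?_
  · refine Eventually.of_forall fun η => ?_
    have := measurable_inMode η x
    fun_prop
  · filter_upwards [self_mem_nhdsWithin] with η hη
    refine ae_of_all _ fun k => ?_
    rw [norm_mul, norm_mul, norm_inMode, norm_neg, norm_mul, norm_mul, norm_mul, norm_I, one_mul,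
      norm_real X', Real.norm_eq_abs]
    calc ‖(k : ℂ)‖ * |X'| * (cutoff η k / √(2 * Real.pi)) * ‖w k‖
        ≤ ‖(k : ℂ)‖ * |X'| * (1 / √(2 * Real.pi)) * ‖w k‖ := by
          gcongr
          exact cutoff_le_one hη k
      _ = _ := by ring
  · filter_upwards [ae_modeMeasure_pos] with k hk
    have h := ((continuous_ofReal.tendsto 1).comp (tendsto_cutoff hk)).mul_const
      (-(I * k * X') * exp (-(I * k * x)) / (Real.sqrt (2 * Real.pi) : ℂ) * w k)
    convert h using 1
    · funext η
      simp only [inMode, Function.comp_apply]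
      ring
    · rw [ofReal_one]
      congr 1
      ring

end IsWave

/-! ### Test functions without negative momenta -/

/-- The momentum space wave function of the one-particle state of `g`. -/
def testWave (g : ℝ → ℂ) (k : ℝ) : ℂ := conj (ft g k)

section

variable {g : 𝓢(ℝ, ℂ)} (hg : ∀ k : ℝ, k < 0 → ft g k = 0)
include hg

/-- Continuity from the left at the origin. This is the infrared condition that makes the test
function a wave. -/
lemma ft_zero_of_forall_neg : ft g 0 = 0 := by
  obtain ⟨h, hh⟩ := exists_schwartz_ft g
  have h1 : Tendsto h (𝓝[<] 0) (𝓝 (h 0)) :=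
    (h.continuous.tendsto 0).mono_left nhdsWithin_le_nhds
  rw [← hh]
  refine tendsto_nhds_unique h1 (tendsto_const_nhds.congr' ?_)
  filter_upwards [self_mem_nhdsWithin] with k hk
  rw [hh, hg k hk]

lemma isWave_testWave : IsWave (testWave g) := by
  obtain ⟨h, hh⟩ := exists_schwartz_ft g
  have hw := isWave_of_schwartz h (by rw [hh, ft_zero_of_forall_neg hg])
  rw [funext hh] at hw
  exact hw.star

/-- The factor `-ik` cancels the weight `1/(2k)`. What remains is the complex conjugate of the
Fourier inversion formula for `g`, whose negative momenta are absent. -/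
lemma waveDeriv_testWave (x : ℝ) : waveDeriv (testWave g) x = -(I / 2) * conj (g x) := by
  obtain ⟨h, hh⟩ := exists_schwartz_ft g
  have hi : Integrable (ft g) := funext hh ▸ h.integrable
  have hz : ∀ k, k ∉ Set.Ioi (0 : ℝ) → exp (I * k * x) * ft g k = 0 := fun k hk => by
    rcases (Set.notMem_Ioi.1 hk).lt_or_eq with hk | rfl
    · rw [hg k hk, mul_zero]
    · rw [ft_zero_of_forall_neg hg, mul_zero]
  rw [← ft_inversion g.continuous g.integrable hi x,
    ← setIntegral_eq_integral_of_forall_compl_eq_zero hz, map_mul, ← integral_conj, waveDeriv,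
    integral_modeMeasure, map_div₀, map_one, conj_ofReal, ← mul_assoc, mul_comm (-(I / 2)),
    mul_assoc, ← integral_const_mul (-(I / 2))]
  congr 1
  refine setIntegral_congr_fun measurableSet_Ioi fun k hk => ?_
  have hk : (k : ℂ) ≠ 0 := by exact_mod_cast (ne_of_gt hk)
  simp only [testWave, map_mul, ← exp_conj, conj_I, conj_ofReal]
  rw [show -I * (k : ℂ) * x = -(I * k * x) by ring]
  field_simp

/-- Both sides are primitives of the same integrable function and vanish at `-∞`. -/
lemma wave_testWave (x : ℝ) : wave (testWave g) x = -(I / 2) * conj (primitive g x) := by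
  have hw := isWave_testWave hg
  have hi : IntegrableOn (waveDeriv (testWave g)) (Set.Iic x) := by
    rw [funext (waveDeriv_testWave hg)]
    exact ((integrable_conj g.integrable).const_mul _).integrableOn
  have h := integral_Iic_of_hasDerivAt_of_tendsto (a := x)
    hw.continuous_wave.continuousWithinAt (fun x _ => hw.hasDerivAt_wave x) hi
    (tendsto_wave_atBot _)
  rw [sub_zero] at h
  rw [← h, primitive, ← integral_conj, ← integral_const_mul]
  simp only [waveDeriv_testWave hg]

end

lemma hasDerivAt_primitive (g : 𝓢(ℝ, ℂ)) (x : ℝ) : HasDerivAt (primitive g) (g x) x := by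
  have h : primitive g = fun y => primitive g 0 + ∫ t in (0 : ℝ)..y, g t := by
    funext y
    rw [primitive, primitive, ← intervalIntegral.integral_Iic_sub_Iic g.integrable.integrableOn
      g.integrable.integrableOn]
    ring
  rw [h]
  exact (intervalIntegral.integral_hasDerivAt_right (g.continuous.intervalIntegrable _ _)
    (g.continuous.stronglyMeasurableAtFilter _ _) g.continuous.continuousAt).const_add _

/-! ### The mean currents: incoming coordinates and subtraction scheme -/

/-- The current density of the wave with wave function `w`. -/
def density (w : ℝ → ℂ) (x : ℝ) : ℂ := currentForm (wave w x) (waveDeriv w x)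

lemma currentForm_ofReal_mul (a b : ℂ) (r : ℝ) : currentForm a (r * b) = r * currentForm a b := by
  simp only [currentForm, map_mul, conj_ofReal]
  ring

lemma tendsto_currentForm {α : Type*} {l : Filter α} {f g : α → ℂ} {a b : ℂ}
    (hf : Tendsto f l (𝓝 a)) (hg : Tendsto g l (𝓝 b)) :
    Tendsto (fun t => currentForm (f t) (g t)) l (𝓝 (currentForm a b)) :=
  ((((continuous_conj.tendsto a).comp hf).mul hg).sub
    (((continuous_conj.tendsto b).comp hg).mul hf)).const_mul I

/-- Normalized wave functions. -/
structure IsUnitWave (w : ℝ → ℂ) : Prop extends IsWave w where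
  normalized : ∫ k, conj (w k) * w k ∂modeMeasure = 1

lemma isCoordChange_id : IsCoordChange id := ⟨contDiff_id, fun y => by simp⟩

lemma IsCoordChange.differentiable {X : ℝ → ℝ} (hX : IsCoordChange X) : Differentiable ℝ X :=
  hX.1.differentiable (by simp)

lemma IsCoordChange.strictMono {X : ℝ → ℝ} (hX : IsCoordChange X) : StrictMono X :=
  strictMono_of_deriv_pos hX.2

/-- A mode function restricted to positive arguments. -/
def posPart (c : ℝ → ℂ) (k : ℝ) : ℂ := if 0 < k then c k else 0

/-- A mode function restricted to negative arguments. -/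
def negPart (c : ℝ → ℂ) (k : ℝ) : ℂ := if k < 0 then c k else 0

lemma posPart_neg {c : ℝ → ℂ} (hc : ∀ k, c (-k) = conj (c k)) (k : ℝ) :
    posPart c (-k) = conj (negPart c k) := by
  simp only [posPart, negPart, Left.neg_pos_iff, hc]
  split_ifs <;> simp

lemma pairing_posPart (w c : ℝ → ℂ) : pairing w (posPart c) = pairing w c := by
  refine integral_congr_ae ?_
  filter_upwards [ae_modeMeasure_pos] with k hk
  simp [posPart, hk]

lemma pairing_negPart (w c : ℝ → ℂ) : pairing w (negPart c) = 0 := by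
  refine (integral_congr_ae (g := 0) ?_).trans (by simp)
  filter_upwards [ae_modeMeasure_pos] with k hk
  simp [negPart, not_lt.2 hk.le]

section

variable {c : ℝ → ℂ} (hm : Measurable c) {η C : ℝ} (hη : 0 < η) {N : ℕ}
  (h : ∀ k, ‖c k‖ ≤ C * (1 + |k|) ^ N * cutoff η k)
include hm hη h

lemma isMode_posPart : IsMode (posPart c) :=
  isMode_of_cutoff_bound (Measurable.ite measurableSet_Ioi hm measurable_const) hη fun k => by
    unfold posPart
    split_ifs
    · exact h k
    · exact norm_zero.trans_le ((norm_nonneg _).trans (h k))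

lemma isMode_negPart : IsMode (negPart c) :=
  isMode_of_cutoff_bound (Measurable.ite measurableSet_Iio hm measurable_const) hη fun k => by
    unfold negPart
    split_ifs
    · exact h k
    · exact norm_zero.trans_le ((norm_nonneg _).trans (h k))

end

lemma deriv_inMode_comp {X : ℝ → ℝ} {y : ℝ} (hX : DifferentiableAt ℝ X y) (η : ℝ) :
    (fun k => deriv (fun z => inMode η (X z) k) y) =
      fun k : ℝ => -(I * k * (deriv X y : ℝ)) * inMode η (X y) k :=
  funext fun k => (hasDerivAt_inMode η k hX.hasDerivAt).deriv

lemma deriv_inPos (η x : ℝ) : (fun k => deriv (fun z => inPos η z k) x) =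
    posPart fun k : ℝ => -(I * k * (1 : ℝ)) * inMode η x k := by
  funext k
  by_cases hk : 0 < k
  · simp only [inPos, posPart, hk, if_true]
    exact (hasDerivAt_inMode η k (hasDerivAt_id x)).deriv
  · simp [inPos, posPart, hk]

lemma deriv_inNeg (η x : ℝ) : (fun k => deriv (fun z => inNeg η z k) x) =
    negPart fun k : ℝ => -(I * k * (1 : ℝ)) * inMode η x k := by
  funext k
  by_cases hk : k < 0
  · simp only [inNeg, negPart, hk, if_true]
    exact (hasDerivAt_inMode η k (hasDerivAt_id x)).deriv
  · simp [inNeg, negPart, hk]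

lemma mul_inMode_neg (η x X' k : ℝ) :
    -(I * ((-k : ℝ) : ℂ) * X') * inMode η x (-k) = conj (-(I * k * X') * inMode η x k) := by
  rw [inMode_neg]
  simp

lemma measurable_mul_inMode (η x X' : ℝ) :
    Measurable fun k : ℝ => -(I * k * X') * inMode η x k := by
  have := measurable_inMode η x
  fun_prop

namespace IsUnitWave

variable {w : ℝ → ℂ} (hw : IsUnitWave w)
include hw

lemma mean_normalCurrent_in {η : ℝ} (hη : 0 < η) (x : ℝ) :
    mean (particle w) (normalCurrent (inPos η) (inNeg η) x) =
      currentForm (pairing w (inMode η x))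
        (pairing w fun k : ℝ => -(I * k * (1 : ℝ)) * inMode η x k) ∧
    mean (antiparticle w) (normalCurrent (inPos η) (inNeg η) x) =
      -currentForm (pairing w (inMode η x))
        (pairing w fun k : ℝ => -(I * k * (1 : ℝ)) * inMode η x k) := by
  have h1 := isMode_posPart (measurable_inMode η x) hη (norm_inMode_le η x)
  have h2 := isMode_negPart (measurable_inMode η x) hη (norm_inMode_le η x)
  have h3 := isMode_posPart (measurable_mul_inMode η x 1) hη (norm_mul_inMode_le η x 1)
  have h4 := isMode_negPart (measurable_mul_inMode η x 1) hη (norm_mul_inMode_le η x 1)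
  have h5 : ∀ k, inPos η x (-k) = conj (inNeg η x k) := posPart_neg (inMode_neg η x)
  have h6 := posPart_neg (c := fun k : ℝ => -(I * k * (1 : ℝ)) * inMode η x k)
    (mul_inMode_neg η x 1)
  have e1 : pairing w (inPos η x) = pairing w (inMode η x) := pairing_posPart w _
  have e2 : pairing w (inNeg η x) = 0 := pairing_negPart w _
  have r1 := mean_particle_normalCurrent hw.memLp hw.normalized (deriv_inPos η x)
    (deriv_inNeg η x) h1 h2 h3 h4 h5 h6
  have r2 := mean_antiparticle_normalCurrent hw.memLp hw.normalized (deriv_inPos η x)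
    (deriv_inNeg η x) h1 h2 h3 h4 h5 h6
  rw [e1, e2, pairing_posPart, pairing_negPart, add_zero, add_zero] at r1 r2
  exact ⟨r1, r2⟩

lemma tendsto_currentForm_inMode {α : Type*} {l : Filter α} {f : α → ℝ}
    (hf : Tendsto f l (𝓝[>] 0)) (x x' X' : ℝ) :
    Tendsto (fun t => currentForm (pairing w (inMode (f t) x'))
      (pairing w fun k : ℝ => -(I * k * X') * inMode (f t) x k)) l
      (𝓝 (X' * currentForm (wave w x') (waveDeriv w x))) := by
  rw [← currentForm_ofReal_mul]
  exact tendsto_currentForm ((hw.tendsto_pairing_inMode x').comp hf)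
    ((hw.tendsto_pairing_mul_inMode x X').comp hf)

lemma hasInCurrent_normalOrdering (x : ℝ) :
    HasInCurrent .normalOrdering (particle w) x (density w x) ∧
      HasInCurrent .normalOrdering (antiparticle w) x (-density w x) := by
  have h := hw.tendsto_currentForm_inMode tendsto_id x x 1
  rw [ofReal_one, one_mul] at h
  constructor
  · refine h.congr' ?_
    filter_upwards [self_mem_nhdsWithin] with η hη
    exact (hw.mean_normalCurrent_in hη x).1.symm
  · refine h.neg.congr' ?_
    filter_upwards [self_mem_nhdsWithin] with η hη
    exact (hw.mean_normalCurrent_in hη x).2.symm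

lemma hasSplitMean {X : ℝ → ℝ} (hX : IsCoordChange X) {ε : ℝ} (hε : ε ≠ 0) (y : ℝ) :
    HasSplitMean X (particle w) ε y
      (deriv X y * currentForm (wave w (X (y + ε))) (waveDeriv w (X y))) ∧
    HasSplitMean X (antiparticle w) ε y
      (-(deriv X y * currentForm (wave w (X (y + ε))) (waveDeriv w (X y)))) := by
  have hne : X (y + ε) ≠ X y := hX.strictMono.injective.ne (by simpa using hε)
  have hv := hasSplitMean_vacuum (hX.differentiable y) hne
  have h := hw.tendsto_currentForm_inMode tendsto_id (X y) (X (y + ε)) (deriv X y)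
  have hd := deriv_inMode_comp (hX.differentiable y)
  constructor
  · have h' := h.add hv
    rw [add_zero] at h'
    refine h'.congr' ?_
    filter_upwards [self_mem_nhdsWithin] with η hη
    exact (mean_particle_splitCurrent rfl (hd η) hw.memLp hw.normalized (isMode_inMode hη _)
      (isMode_mul_inMode hη _ _)).symm
  · have h' := h.neg.add hv
    rw [add_zero] at h'
    refine h'.congr' ?_
    filter_upwards [self_mem_nhdsWithin] with η hη
    exact (mean_antiparticle_splitCurrent rfl (hd η) hw.memLp hw.normalized (isMode_inMode hη _)
      (isMode_mul_inMode hη _ _) (inMode_neg η _) (mul_inMode_neg η _ _)).symm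

lemma hasOutCurrent_subtraction {X : ℝ → ℝ} (hX : IsCoordChange X) (y : ℝ) :
    HasOutCurrent .subtraction X (particle w) y (deriv X y * density w (X y)) ∧
      HasOutCurrent .subtraction X (antiparticle w) y (-(deriv X y * density w (X y))) := by
  -- The subtracted vacuum mean is already zero at each nonzero separation, so only continuity of
  -- the wave is needed for the limit.
  have hv : ∀ ε ≠ 0, HasSplitMean id vacuum ε (X y) 0 := fun ε hε =>
    hasSplitMean_vacuum differentiableAt_id (by simpa using hε)
  have h : Tendsto (fun ε => deriv X y * currentForm (wave w (X (y + ε))) (waveDeriv w (X y)))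
      (𝓝[≠] 0) (𝓝 (deriv X y * density w (X y))) := by
    have hc : Continuous fun ε => wave w (X (y + ε)) :=
      hw.continuous_wave.comp (hX.differentiable.continuous.comp (by fun_prop))
    have ht := (hc.tendsto 0).mono_left (nhdsWithin_le_nhds (s := {0}ᶜ))
    rw [add_zero] at ht
    exact (tendsto_currentForm ht tendsto_const_nhds).const_mul _
  refine ⟨⟨_, fun _ => 0, fun ε hε => ⟨(hw.hasSplitMean hX hε y).1, hv ε hε⟩, ?_⟩,
    ⟨_, fun _ => 0, fun ε hε => ⟨(hw.hasSplitMean hX hε y).2, hv ε hε⟩, ?_⟩⟩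
  · simpa using h
  · simpa using h.neg

lemma hasInCurrent (s : Scheme) (x : ℝ) :
    HasInCurrent s (particle w) x (density w x) ∧
      HasInCurrent s (antiparticle w) x (-density w x) := by
  cases s
  · exact hw.hasInCurrent_normalOrdering x
  -- In the subtraction scheme the incoming current is the outgoing one for the identity change of
  -- coordinates.
  · have h := hw.hasOutCurrent_subtraction isCoordChange_id x
    simp only [deriv_id, ofReal_one, one_mul, id] at h
    exact h

end IsUnitWave

/-! ### Charges -/

lemma isUnitWave_testWave {g : 𝓢(ℝ, ℂ)} (hg : IsNormalizedTest g) : IsUnitWave (testWave g) where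
  toIsWave := isWave_testWave hg.1
  normalized := by
    rw [← ofReal_one, ← hg.2, ← integral_complex_ofReal]
    congr 1
    funext k
    simp [testWave, mul_conj']

section

variable {g : 𝓢(ℝ, ℂ)} (hg : ∀ k : ℝ, k < 0 → ft g k = 0)
include hg

lemma density_testWave (x : ℝ) : density (testWave g) x =
    (1 / 2) * (wave (testWave g) x * g x + conj (wave (testWave g) x * g x)) := by
  simp only [density, currentForm, waveDeriv_testWave hg, map_mul, map_neg, map_div₀, conj_I,
    conj_conj, map_ofNat]
  ring_nf
  rw [I_sq]
  ring

lemma density_testWave_eq_biDeriv (x : ℝ) : density (testWave g) x =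
    -(I / 4) * biDeriv (fun t => conj (primitive g t)) (primitive g) x := by
  have h1 := hasDerivAt_primitive g x
  have h2 : HasDerivAt (fun t => conj (primitive g t)) (conj (g x)) x := h1.star
  rw [biDeriv, h1.deriv, h2.deriv, density, currentForm, waveDeriv_testWave hg,
    wave_testWave hg]
  simp only [map_mul, map_neg, map_div₀, conj_I, conj_conj, map_ofNat]
  ring_nf
  simp only [show I ^ 3 = -I by rw [pow_succ, I_sq]; ring]
  ring

lemma deriv_mul_density_eq_biDeriv {X : ℝ → ℝ} {y : ℝ} (hX : DifferentiableAt ℝ X y) :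
    deriv X y * density (testWave g) (X y) = -(I / 4) *
      biDeriv (fun t => conj (primitive g (X t))) (fun t => primitive g (X t)) y := by
  have h1 := hasDerivAt_primitive g (X y)
  have h2 : HasDerivAt (fun t => conj (primitive g t)) (conj (g (X y))) (X y) := h1.star
  have h3 : HasDerivAt (fun t => primitive g (X t)) (deriv X y * g (X y)) y := by
    exact (h1.scomp y hX.hasDerivAt).congr_deriv (by simp)
  have h4 : HasDerivAt (fun t => conj (primitive g (X t))) (deriv X y * conj (g (X y))) y := by
    exact (h2.scomp y hX.hasDerivAt).congr_deriv (by simp)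
  rw [density_testWave_eq_biDeriv hg, biDeriv, biDeriv, h1.deriv, h2.deriv, h3.deriv, h4.deriv]
  ring

lemma integrable_wave_mul : Integrable fun x => wave (testWave g) x * g x :=
  g.integrable.bdd_mul (isWave_testWave hg).continuous_wave.aestronglyMeasurable
    (ae_of_all _ fun x => norm_wave_le _ x)

lemma integrable_density : Integrable (density (testWave g)) := by
  rw [funext (density_testWave hg)]
  exact ((integrable_wave_mul hg).add (integrable_conj (integrable_wave_mul hg))).const_mul _

/-- By Fubini, integrating over `x` first reproduces `ft g`, the conjugate of the wave function. The
position-space charge is thus the momentum-space norm. -/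
lemma integral_wave_mul :
    ∫ x, wave (testWave g) x * g x = ∫ k, conj (testWave g k) * testWave g k ∂modeMeasure := by
  have hw := isWave_testWave hg
  have hi : Integrable (Function.uncurry fun (x k : ℝ) =>
      exp (-(I * k * x)) * testWave g k * g x) (volume.prod modeMeasure) := by
    refine (g.integrable.mul_prod hw.integrable).mono ?_ (ae_of_all _ fun p => ?_)
    · have := hw.measurable
      have := g.continuous.measurable
      exact Measurable.aestronglyMeasurable (by unfold Function.uncurry; fun_prop)
    · simp only [Function.uncurry, norm_mul, norm_exp_phase, one_mul]
      exact le_of_eq (mul_comm _ _)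
  simp only [wave, mul_assoc, ← integral_mul_const]
  rw [integral_const_mul]
  simp only [← mul_assoc]
  rw [integral_integral_swap hi, ← integral_const_mul]
  congr 1
  funext k
  rw [show conj (testWave g k) = ft g k by simp [testWave], ft]
  simp only [mul_right_comm _ (testWave g k), integral_mul_const]
  ring

end

lemma integral_density {g : 𝓢(ℝ, ℂ)} (hg : IsNormalizedTest g) :
    ∫ x, density (testWave g) x = 1 := by
  simp only [density_testWave hg.1]
  rw [integral_const_mul, integral_add (integrable_wave_mul hg.1)
    (integrable_conj (integrable_wave_mul hg.1)), integral_conj, integral_wave_mul hg.1,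
    (isUnitWave_testWave hg).normalized]
  norm_num

/-! ### The black holes -/

lemma hasDerivAt_rbh (y : ℝ) : HasDerivAt rbh (Real.exp (-y)) y := by
  have h := ((hasDerivAt_id y).neg.exp).neg
  exact h.congr_deriv (by simp)

lemma hasDerivAt_cghs (y : ℝ) :
    HasDerivAt cghs (Real.exp (-y) / (1 + Real.exp (-y))) y := by
  have h := (((hasDerivAt_id y).neg.exp).const_add 1).log (by positivity) |>.neg
  refine h.congr_deriv ?_
  simp [neg_div]

lemma isCoordChange_rbh : IsCoordChange rbh := by
  refine ⟨by unfold rbh; fun_prop, fun y => ?_⟩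
  rw [(hasDerivAt_rbh y).deriv]
  positivity

lemma isCoordChange_cghs : IsCoordChange cghs := by
  refine ⟨?_, fun y => ?_⟩
  · unfold cghs
    exact (ContDiff.log (by fun_prop) fun y => by positivity).neg
  · rw [(hasDerivAt_cghs y).deriv]
    positivity

lemma range_rbh : Set.range rbh = Set.Iio 0 := by
  ext x
  constructor
  · rintro ⟨y, rfl⟩
    simp [rbh, Real.exp_pos]
  · intro hx
    have hx : x < 0 := hx
    exact ⟨-Real.log (-x), by rw [rbh, neg_neg, Real.exp_log (neg_pos.2 hx), neg_neg]⟩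

lemma range_cghs : Set.range cghs = Set.Iio 0 := by
  ext x
  constructor
  · rintro ⟨y, rfl⟩
    exact neg_neg_of_pos (Real.log_pos (by linarith [Real.exp_pos (-y)]))
  · intro hx
    have hx : 0 < Real.exp (-x) - 1 := by
      have : x < 0 := hx
      have := Real.one_lt_exp_iff.2 (neg_pos.2 this)
      linarith
    exact ⟨-Real.log (Real.exp (-x) - 1), by simp [cghs, Real.exp_log hx]⟩

lemma isCoordChange_and_range {X : ℝ → ℝ} (hX : X = rbh ∨ X = cghs) :
    IsCoordChange X ∧ Set.range X = Set.Iio 0 := by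
  rcases hX with rfl | rfl
  exacts [⟨isCoordChange_rbh, range_rbh⟩, ⟨isCoordChange_cghs, range_cghs⟩]

/-- The substitution `x = X(y)`; the range need not be the whole line, and this is where charge can
be lost. -/
lemma integrable_and_integral_comp {X : ℝ → ℝ} (hX : IsCoordChange X) {f : ℝ → ℂ}
    (hf : Integrable f) :
    Integrable (fun y => deriv X y * f (X y)) ∧
      ∫ y, deriv X y * f (X y) = ∫ x in Set.range X, f x := by
  have hd : ∀ y ∈ Set.univ, HasDerivWithinAt X (deriv X y) Set.univ y := fun y _ =>
    (hX.differentiable y).hasDerivAt.hasDerivWithinAt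
  have hi : Set.InjOn X Set.univ := hX.strictMono.injective.injOn
  have habs : ∀ y, |deriv X y| • f (X y) = deriv X y * f (X y) := fun y => by
    rw [abs_of_pos (hX.2 y), real_smul]
  constructor
  · have := (integrableOn_image_iff_integrableOn_abs_deriv_smul MeasurableSet.univ hd hi f).1
      hf.integrableOn
    simpa only [habs, integrableOn_univ] using this
  · rw [← Set.image_univ, integral_image_eq_integral_abs_deriv_smul MeasurableSet.univ hd hi f]
    simp only [habs, Measure.restrict_univ]

/-! ### Oscillatory integrals -/

/-- The oscillatory integral `∫ exp(-ikX(y)) exp(ipy) h(y) dy`. -/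
def oscInt (X h : ℝ → ℝ) (k p : ℝ) : ℂ :=
  ∫ y : ℝ, exp (-(I * k * (X y : ℂ))) * exp (I * p * y) * (h y : ℂ)

/-- Smooth functions with compact support. -/
def IsBump (h : ℝ → ℝ) : Prop := ContDiff ℝ ∞ h ∧ HasCompactSupport h

lemma norm_exp_phase_pos (k x : ℝ) : ‖exp (I * k * x)‖ = 1 := by
  have := norm_exp_phase (-k) x
  rwa [show -(I * ((-k : ℝ) : ℂ) * x) = I * k * x by push_cast; ring] at this

section

variable {X h : ℝ → ℝ} (hX : ContDiff ℝ ∞ X) (hh : IsBump h)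

include hh in
lemma IsBump.deriv : IsBump (deriv h) :=
  ⟨(contDiff_infty_iff_deriv.1 hh.1).2, hh.2.deriv⟩

include hX hh in
lemma IsBump.deriv_mul : IsBump fun y => _root_.deriv X y * h y :=
  ⟨(contDiff_infty_iff_deriv.1 hX).2.mul hh.1, hh.2.mul_left⟩

include hh in
lemma IsBump.integrable : Integrable h := hh.1.continuous.integrable_of_hasCompactSupport hh.2

include hX hh in
lemma integrable_osc (k p : ℝ) :
    Integrable fun y : ℝ => exp (-(I * k * (X y : ℂ))) * exp (I * p * y) * (h y : ℂ) := by
  have hc := hX.continuous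
  refine hh.integrable.ofReal.bdd_mul (c := 1) (by fun_prop) (ae_of_all _ fun y => ?_)
  rw [norm_mul, norm_exp_phase, norm_exp_phase_pos, one_mul]

include hX hh in
-- Integration by parts against `exp (ipy)`. The new amplitudes `X' h` and `h'` are again bumps, so
-- the identity can be iterated.
lemma mul_oscInt (k p : ℝ) : I * p * oscInt X h k p =
    I * k * oscInt X (fun y => deriv X y * h y) k p - oscInt X (deriv h) k p := by
  have hXd : Differentiable ℝ X := hX.differentiable (by simp)
  have hhd : Differentiable ℝ h := hh.1.differentiable (by simp)
  have hu : ∀ y : ℝ, HasDerivAt (fun y : ℝ => exp (-(I * k * (X y : ℂ))) * (h y : ℂ))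
      (-(I * k * (deriv X y : ℝ)) * exp (-(I * k * (X y : ℂ))) * (h y : ℂ) +
        exp (-(I * k * (X y : ℂ))) * (deriv h y : ℝ)) y := fun y => by
    have h1 := (((hXd y).hasDerivAt.ofReal_comp.const_mul (I * k)).neg.cexp).mul
      (hhd y).hasDerivAt.ofReal_comp
    refine h1.congr_deriv ?_
    simp only [Pi.neg_apply]
    ring
  have hv : ∀ y : ℝ, HasDerivAt (fun y : ℝ => exp (I * p * y)) (I * p * exp (I * p * y)) y :=
    fun y => by
      have h1 := (((hasDerivAt_id y).ofReal_comp).const_mul (I * p)).cexp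
      refine h1.congr_deriv ?_
      simp only [id, ofReal_one]
      ring
  have i0 := integrable_osc hX hh k p
  have i1 := integrable_osc hX hh.deriv k p
  have i2 := integrable_osc hX (hh.deriv_mul hX) k p
  have e : ∀ y : ℝ, (-(I * k * (deriv X y : ℝ)) * exp (-(I * k * (X y : ℂ))) * (h y : ℂ) +
        exp (-(I * k * (X y : ℂ))) * (deriv h y : ℝ)) * exp (I * p * y) =
      exp (-(I * k * (X y : ℂ))) * exp (I * p * y) * (deriv h y : ℝ) -
        I * k * (exp (-(I * k * (X y : ℂ))) * exp (I * p * y) * ((deriv X y * h y : ℝ) : ℂ)) :=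
    fun y => by push_cast; ring
  have e' : ∀ y : ℝ, exp (-(I * k * (X y : ℂ))) * (h y : ℂ) * (I * p * exp (I * p * y)) =
      I * p * (exp (-(I * k * (X y : ℂ))) * exp (I * p * y) * (h y : ℂ)) := fun y => by ring
  have key := integral_mul_deriv_eq_deriv_mul_of_integrable (fun y _ => hu y) (fun y _ => hv y)
    (by
      refine (i0.const_mul (I * p)).congr (ae_of_all _ fun y => ?_)
      exact (e' y).symm)
    (by
      refine (i1.sub (i2.const_mul (I * k))).congr (ae_of_all _ fun y => ?_)
      exact (e y).symm)
    (by
      refine i0.congr (ae_of_all _ fun y => ?_)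
      simp only [Pi.mul_apply]
      ring)
  simp only [e, e'] at key
  rw [integral_const_mul, integral_sub i1 (i2.const_mul _), integral_const_mul] at key
  unfold oscInt
  rw [key]
  ring

include hX in
-- Each power of `p` costs one integration by parts, hence one power of `1 + |k|`. The amplitude
-- changes at every step, so the induction runs over all bumps at once.
lemma exists_pow_mul_oscInt_le (n : ℕ) : ∀ {h : ℝ → ℝ}, IsBump h →
    ∃ C, 0 ≤ C ∧ ∀ k p : ℝ, |p| ^ n * ‖oscInt X h k p‖ ≤ C * (1 + |k|) ^ n := by
  induction n with
  | zero =>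
    intro h hh
    refine ⟨∫ y, ‖(h y : ℂ)‖, by positivity, fun k p => ?_⟩
    rw [pow_zero, pow_zero, one_mul, mul_one]
    refine (norm_integral_le_integral_norm _).trans (le_of_eq ?_)
    simp only [norm_mul, norm_exp_phase, norm_exp_phase_pos, one_mul]
  | succ n ih =>
    intro h hh
    obtain ⟨C₁, h₁, hC₁⟩ := ih hh.deriv
    obtain ⟨C₂, h₂, hC₂⟩ := ih (hh.deriv_mul hX)
    refine ⟨C₁ + C₂, by positivity, fun k p => ?_⟩
    have e : |p| * ‖oscInt X h k p‖ = ‖I * p * oscInt X h k p‖ := by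
      rw [norm_mul, norm_mul, norm_I, one_mul, norm_real, Real.norm_eq_abs]
    have hk := abs_nonneg k
    calc |p| ^ (n + 1) * ‖oscInt X h k p‖ = |p| ^ n * ‖I * p * oscInt X h k p‖ := by
          rw [← e]; ring
      _ ≤ |p| ^ n * (|k| * ‖oscInt X (fun y => deriv X y * h y) k p‖ +
          ‖oscInt X (deriv h) k p‖) := by
          rw [mul_oscInt hX hh]
          gcongr
          refine (norm_sub_le _ _).trans (le_of_eq ?_)
          rw [norm_mul, norm_mul, norm_I, one_mul, norm_real, Real.norm_eq_abs]
      _ = |k| * (|p| ^ n * ‖oscInt X (fun y => deriv X y * h y) k p‖) +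
          |p| ^ n * ‖oscInt X (deriv h) k p‖ := by ring
      _ ≤ |k| * (C₂ * (1 + |k|) ^ n) + C₁ * (1 + |k|) ^ n := by
          exact add_le_add (mul_le_mul_of_nonneg_left (hC₂ k p) hk) (hC₁ k p)
      _ ≤ (1 + |k|) * (C₂ * (1 + |k|) ^ n) + (1 + |k|) * (C₁ * (1 + |k|) ^ n) := by
          have : 0 ≤ C₁ * (1 + |k|) ^ n := by positivity
          have : 0 ≤ C₂ * (1 + |k|) ^ n := by positivity
          nlinarith
      _ = (C₁ + C₂) * (1 + |k|) ^ (n + 1) := by ring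

include hX hh in
-- Three powers of `p` are what the expansion of `(1 + |p|)(1 + p²)` requires; the extra factor `1 +
-- |p|` later allows differentiation in `y` under the integral.
lemma exists_oscInt_le : ∃ C, 0 ≤ C ∧ ∀ k p : ℝ,
    (1 + |p|) * ‖oscInt X h k p‖ ≤ C * (1 + |k|) ^ 3 * (1 + p ^ 2)⁻¹ := by
  obtain ⟨C₀, h₀, hC₀⟩ := exists_pow_mul_oscInt_le hX 0 hh
  obtain ⟨C₁, h₁, hC₁⟩ := exists_pow_mul_oscInt_le hX 1 hh
  obtain ⟨C₂, h₂, hC₂⟩ := exists_pow_mul_oscInt_le hX 2 hh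
  obtain ⟨C₃, h₃, hC₃⟩ := exists_pow_mul_oscInt_le hX 3 hh
  refine ⟨C₀ + C₁ + C₂ + C₃, by positivity, fun k p => ?_⟩
  have hp : 0 < 1 + p ^ 2 := by positivity
  have hk : 1 ≤ 1 + |k| := by linarith [abs_nonneg k]
  rw [← div_eq_mul_inv, le_div_iff₀ hp, ← sq_abs]
  calc (1 + |p|) * ‖oscInt X h k p‖ * (1 + |p| ^ 2)
      = |p| ^ 0 * ‖oscInt X h k p‖ + |p| ^ 1 * ‖oscInt X h k p‖ +
        |p| ^ 2 * ‖oscInt X h k p‖ + |p| ^ 3 * ‖oscInt X h k p‖ := by ring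
    _ ≤ C₀ * (1 + |k|) ^ 0 + C₁ * (1 + |k|) ^ 1 + C₂ * (1 + |k|) ^ 2 + C₃ * (1 + |k|) ^ 3 := by
        exact add_le_add (add_le_add (add_le_add (hC₀ k p) (hC₁ k p)) (hC₂ k p)) (hC₃ k p)
    _ ≤ C₀ * (1 + |k|) ^ 3 + C₁ * (1 + |k|) ^ 3 + C₂ * (1 + |k|) ^ 3 + C₃ * (1 + |k|) ^ 3 := by
        gcongr <;> first | exact hk | norm_num
    _ = (C₀ + C₁ + C₂ + C₃) * (1 + |k|) ^ 3 := by ring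

include hX hh in
lemma continuous_oscInt : Continuous fun q : ℝ × ℝ => oscInt X h q.1 q.2 := by
  have hc := hX.continuous
  have hc' := hh.1.continuous
  have h1 := continuous_parametric_integral_of_continuous (μ := volume) (s := tsupport h)
    (f := fun (q : ℝ × ℝ) (y : ℝ) =>
      exp (-(I * q.1 * (X y : ℂ))) * exp (I * q.2 * y) * (h y : ℂ))
    (by unfold Function.uncurry; fun_prop) hh.2
  refine h1.congr fun q => setIntegral_eq_integral_of_forall_compl_eq_zero fun y hy => ?_
  rw [image_eq_zero_of_notMem_tsupport hy, ofReal_zero, mul_zero]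

lemma oscInt_neg (X h : ℝ → ℝ) (k p : ℝ) : oscInt X h (-k) p = conj (oscInt X h k (-p)) := by
  simp only [oscInt, ← integral_conj, map_mul, ← exp_conj, map_neg, conj_I, conj_ofReal]
  congr 1
  funext y
  push_cast
  ring_nf

/-! ### Projections to outgoing momenta -/

/-- The part of `2π exp(-ikX(y)) h(y)` with outgoing momenta in `S`. -/
def proj (S : Set ℝ) (X h : ℝ → ℝ) (k y : ℝ) : ℂ :=
  ∫ p in S, exp (-(I * p * y)) * oscInt X h k p

/-- The derivative of `proj`. -/
def projDeriv (S : Set ℝ) (X h : ℝ → ℝ) (k y : ℝ) : ℂ :=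
  ∫ p in S, -(I * p) * exp (-(I * p * y)) * oscInt X h k p

include hX hh in
lemma exists_proj_bounds : ∃ C, 0 ≤ C ∧ ∀ k p y : ℝ,
    ‖exp (-(I * p * y)) * oscInt X h k p‖ ≤ C * (1 + |k|) ^ 3 * (1 + p ^ 2)⁻¹ ∧
    ‖-(I * p) * exp (-(I * p * y)) * oscInt X h k p‖ ≤ C * (1 + |k|) ^ 3 * (1 + p ^ 2)⁻¹ := by
  obtain ⟨C, hC, h⟩ := exists_oscInt_le hX hh
  refine ⟨C, hC, fun k p y => ⟨le_trans ?_ (h k p), le_trans ?_ (h k p)⟩⟩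
  · rw [norm_mul, norm_exp_phase]
    gcongr
    linarith [abs_nonneg p]
  · rw [norm_mul, norm_mul, norm_exp_phase, norm_neg, norm_mul, norm_I, one_mul, mul_one,
      norm_real, Real.norm_eq_abs]
    gcongr
    linarith

include hX hh in
lemma integrable_proj (k y : ℝ) : Integrable fun p : ℝ => exp (-(I * p * y)) * oscInt X h k p := by
  obtain ⟨C, -, hC⟩ := exists_proj_bounds hX hh
  have hc := (continuous_oscInt hX hh).comp (Continuous.prodMk_right k)
  simp only [Function.comp_def] at hc
  exact (integrable_inv_one_add_sq.const_mul _).mono' (by fun_prop)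
    (ae_of_all _ fun p => (hC k p y).1)

include hX hh in
lemma hasDerivAt_proj (S : Set ℝ) (k y : ℝ) :
    HasDerivAt (proj S X h k) (projDeriv S X h k y) y := by
  obtain ⟨C, -, hC⟩ := exists_proj_bounds hX hh
  have hc := (continuous_oscInt hX hh).comp (Continuous.prodMk_right k)
  simp only [Function.comp_def] at hc
  refine (hasDerivAt_integral_of_dominated_loc_of_deriv_le
    (F := fun (y p : ℝ) => exp (-(I * p * y)) * oscInt X h k p)
    (F' := fun (y p : ℝ) => -(I * p) * exp (-(I * p * y)) * oscInt X h k p)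
    (bound := fun p => C * (1 + |k|) ^ 3 * (1 + p ^ 2)⁻¹) univ_mem
    (Eventually.of_forall fun _ => by fun_prop) (integrable_proj hX hh k y).integrableOn
    (by fun_prop) (ae_of_all _ fun p y _ => (hC k p y).2)
    (integrable_inv_one_add_sq.const_mul _).integrableOn (ae_of_all _ fun p y _ => ?_)).2
  have h1 := ((((hasDerivAt_id y).ofReal_comp).const_mul (I * p)).neg.cexp).mul_const
    (oscInt X h k p)
  refine h1.congr_deriv ?_
  simp only [Pi.neg_apply, id, ofReal_one]
  ring

include hX hh in
lemma exists_norm_proj_le (S : Set ℝ) : ∃ C, ∀ k y : ℝ,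
    ‖proj S X h k y‖ ≤ C * (1 + |k|) ^ 3 ∧ ‖projDeriv S X h k y‖ ≤ C * (1 + |k|) ^ 3 := by
  obtain ⟨C, -, hC⟩ := exists_proj_bounds hX hh
  have hi : ∀ D : ℝ, IntegrableOn (fun p : ℝ => D * (1 + p ^ 2)⁻¹) S := fun D =>
    (integrable_inv_one_add_sq.const_mul D).integrableOn
  refine ⟨C * ∫ p in S, (1 + p ^ 2)⁻¹, fun k y => ?_⟩
  rw [mul_right_comm, ← integral_const_mul]
  exact ⟨norm_integral_le_of_norm_le (hi _) (ae_of_all _ fun p => (hC k p y).1),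
    norm_integral_le_of_norm_le (hi _) (ae_of_all _ fun p => (hC k p y).2)⟩

include hX hh in
lemma measurable_proj (S : Set ℝ) (y : ℝ) :
    Measurable (fun k => proj S X h k y) ∧ Measurable (fun k => projDeriv S X h k y) := by
  have hc := continuous_oscInt hX hh
  constructor
  · exact (StronglyMeasurable.integral_prod_right' (ν := volume.restrict S)
      (f := fun q : ℝ × ℝ => exp (-(I * q.2 * y)) * oscInt X h q.1 q.2)
      (Continuous.stronglyMeasurable (by fun_prop))).measurable
  · exact (StronglyMeasurable.integral_prod_right' (ν := volume.restrict S)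
      (f := fun q : ℝ × ℝ => -(I * q.2) * exp (-(I * q.2 * y)) * oscInt X h q.1 q.2)
      (Continuous.stronglyMeasurable (by fun_prop))).measurable

include hX hh in
-- The two half-lines together give the full inverse Fourier transform of `exp (-ikX) h`; its
-- transform is integrable by the decay of the oscillatory integral.
lemma proj_add_proj (k y : ℝ) : proj (Set.Ioi 0) X h k y + proj (Set.Iic 0) X h k y =
    2 * Real.pi * (exp (-(I * k * (X y : ℂ))) * (h y : ℂ)) := by
  have hc := hX.continuous
  have hc' := hh.1.continuous
  set f : ℝ → ℂ := fun y => exp (-(I * k * (X y : ℂ))) * (h y : ℂ) with hf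
  have hft : ∀ p : ℝ, oscInt X h k p = (Real.sqrt (2 * Real.pi) : ℂ) * ft f (-p) := by
    intro p
    rw [ft, ← mul_assoc, mul_one_div_cancel sqrt_two_pi_ne_zero, one_mul, oscInt]
    congr 1
    funext y
    rw [hf, ofReal_neg, mul_neg, neg_mul, neg_neg]
    ring
  have hfi : Integrable f := by
    simpa only [ofReal_zero, mul_zero, zero_mul, exp_zero, mul_one] using integrable_osc hX hh k 0
  have hfti : Integrable (ft f) := by
    have h1 := ((integrable_proj hX hh k 0).const_mul
      (1 / (Real.sqrt (2 * Real.pi) : ℂ))).comp_neg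
    refine h1.congr (ae_of_all _ fun p => ?_)
    simp only [hft, ofReal_zero, mul_zero, neg_zero, exp_zero, one_mul, neg_neg]
    rw [← mul_assoc, one_div_mul_cancel sqrt_two_pi_ne_zero, one_mul]
  have hinv := ft_inversion (by fun_prop) hfi hfti y
  have hi := integrable_proj hX hh k y
  unfold proj
  rw [← Set.compl_Ioi, integral_add_compl measurableSet_Ioi hi, ← integral_neg_eq_self]
  simp only [hft, neg_neg]
  rw [show exp (-(I * k * (X y : ℂ))) * (h y : ℂ) = f y from rfl, ← hinv, ← sqrt_two_pi_mul_self,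
    ← mul_assoc, mul_assoc _ _ (1 / _ : ℂ), mul_one_div_cancel sqrt_two_pi_ne_zero, mul_one,
    ← integral_const_mul]
  congr 1
  funext p
  rw [ofReal_neg, mul_neg, neg_mul, neg_neg]
  ring

end

/-! ### The mean currents: normal ordering in the outgoing coordinates -/

lemma kernelU_eq (X χ : ℝ → ℝ) (k p : ℝ) :
    kernelU X χ k p = (1 / (2 * Real.pi : ℂ)) * oscInt X χ k p := rfl

/-- The constant factor and the cut-off of the outgoing modes. -/
def outFactor (η k : ℝ) : ℂ :=
  (1 / (Real.sqrt (2 * Real.pi) : ℂ)) * (1 / (2 * Real.pi : ℂ)) * cutoff η k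

/-- The normalization `2p` of the outgoing operators cancels the weight `1/(2p)`, leaving a Lebesgue
integral over momenta. -/
lemma outPos_eq (X χ : ℝ → ℝ) (η y k : ℝ) :
    outPos X χ η y k = outFactor η k * proj (Set.Ioi 0) X χ k y := by
  rw [outPos, integral_modeMeasure, outFactor, proj, mul_assoc, mul_assoc]
  congr 1
  rw [← mul_assoc, ← integral_const_mul]
  refine setIntegral_congr_fun measurableSet_Ioi fun p hp => ?_
  have hp : (p : ℂ) ≠ 0 := by exact_mod_cast (ne_of_gt hp)
  simp only [aOut, kernelU_eq]
  field_simp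

lemma integral_Iic_zero_eq (f : ℝ → ℂ) :
    ∫ p in Set.Iic 0, f p = ∫ p in Set.Ioi (0 : ℝ), f (-p) := by
  have h := integral_comp_neg_Ioi (0 : ℝ) f
  rw [neg_zero] at h
  exact h.symm

lemma outNeg_eq (X χ : ℝ → ℝ) (η y k : ℝ) :
    outNeg X χ η y k = outFactor η k * proj (Set.Iic 0) X χ k y := by
  rw [outNeg, integral_modeMeasure, outFactor, proj, mul_assoc, mul_assoc]
  congr 1
  rw [integral_Iic_zero_eq, ← mul_assoc, ← integral_const_mul]
  refine setIntegral_congr_fun measurableSet_Ioi fun p hp => ?_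
  have hp : (p : ℂ) ≠ 0 := by
    exact_mod_cast (ne_of_gt hp)
  simp only [bOutDag, kernelU_eq, ofReal_neg, mul_neg, neg_mul, neg_neg]
  field_simp

lemma outFactor_neg (η k : ℝ) : outFactor η (-k) = outFactor η k := by
  simp only [outFactor, cutoff_neg]

lemma conj_outFactor (η k : ℝ) : conj (outFactor η k) = outFactor η k := by
  simp only [outFactor, map_mul, map_div₀, map_one, map_ofNat, conj_ofReal]

/-- This reflection symmetry is the charge-conjugation relation needed to cancel the vacuum terms.
-/
lemma outPos_neg (X χ : ℝ → ℝ) (η y k : ℝ) :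
    outPos X χ η y (-k) = conj (outNeg X χ η y k) := by
  rw [outPos_eq, outNeg_eq, map_mul, outFactor_neg, conj_outFactor, proj, proj,
    integral_Iic_zero_eq, ← integral_conj]
  congr 2
  funext p
  rw [oscInt_neg, map_mul, ← exp_conj]
  simp

lemma norm_outFactor_mul_le {η C k : ℝ} {z : ℂ} (hz : ‖z‖ ≤ C * (1 + |k|) ^ 3) :
    ‖outFactor η k * z‖ ≤ ‖(1 / (Real.sqrt (2 * Real.pi) : ℂ)) * (1 / (2 * Real.pi : ℂ))‖ * C *
      (1 + |k|) ^ 3 * cutoff η k := by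
  rw [outFactor, norm_mul, norm_mul, norm_real, Real.norm_of_nonneg (cutoff_nonneg η k)]
  have := cutoff_nonneg η k
  calc _ ≤ ‖(1 / (Real.sqrt (2 * Real.pi) : ℂ)) * (1 / (2 * Real.pi : ℂ))‖ * cutoff η k *
        (C * (1 + |k|) ^ 3) := by gcongr
    _ = _ := by ring

lemma measurable_outFactor (η : ℝ) : Measurable (outFactor η) := by
  have := measurable_cutoff η
  unfold outFactor
  fun_prop

section

variable {X χ : ℝ → ℝ} (hX : ContDiff ℝ ∞ X) (hχ : IsBump χ) {η : ℝ}
include hX hχ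

/-- The projections grow at most like `(1 + |k|) ^ 3`, which the damping in `outFactor` absorbs. -/
lemma isMode_outFactor_mul_proj (hη : 0 < η) (S : Set ℝ) (y : ℝ) :
    IsMode (fun k => outFactor η k * proj S X χ k y) ∧
      IsMode (fun k => outFactor η k * projDeriv S X χ k y) := by
  obtain ⟨C, hC⟩ := exists_norm_proj_le hX hχ S
  have hm := measurable_proj hX hχ S y
  exact ⟨isMode_of_cutoff_bound ((measurable_outFactor η).mul hm.1) hη
      fun k => norm_outFactor_mul_le (hC k y).1,
    isMode_of_cutoff_bound ((measurable_outFactor η).mul hm.2) hη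
      fun k => norm_outFactor_mul_le (hC k y).2⟩

lemma hasDerivAt_outPos (y k : ℝ) : HasDerivAt (fun z => outPos X χ η z k)
    (outFactor η k * projDeriv (Set.Ioi 0) X χ k y) y := by
  simp only [outPos_eq]
  exact (hasDerivAt_proj hX hχ _ k y).const_mul _

lemma hasDerivAt_outNeg (y k : ℝ) : HasDerivAt (fun z => outNeg X χ η z k)
    (outFactor η k * projDeriv (Set.Iic 0) X χ k y) y := by
  simp only [outNeg_eq]
  exact (hasDerivAt_proj hX hχ _ k y).const_mul _

lemma outPos_add_outNeg (y k : ℝ) :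
    outPos X χ η y k + outNeg X χ η y k = χ y * inMode η (X y) k := by
  rw [outPos_eq, outNeg_eq, ← mul_add, proj_add_proj hX hχ, outFactor, inMode]
  have := sqrt_two_pi_ne_zero
  have hpi : (Real.pi : ℂ) ≠ 0 := by exact_mod_cast Real.pi_ne_zero
  field_simp

/-- Uniqueness of the derivative, applied to both sides of `outPos_add_outNeg`; no second Fourier
inversion is needed. -/
lemma deriv_outPos_add_deriv_outNeg (y k : ℝ) :
    outFactor η k * projDeriv (Set.Ioi 0) X χ k y + outFactor η k * projDeriv (Set.Iic 0) X χ k y =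
      (deriv χ y : ℝ) * inMode η (X y) k +
        χ y * (-(I * k * (deriv X y : ℝ)) * inMode η (X y) k) := by
  have h1 := (hasDerivAt_outPos hX hχ (η := η) y k).add (hasDerivAt_outNeg hX hχ (η := η) y k)
  have h2 := ((hχ.1.differentiable (by simp)) y).hasDerivAt.ofReal_comp.mul
    (hasDerivAt_inMode η k ((hX.differentiable (by simp)) y).hasDerivAt)
  refine h1.unique (h2.congr_of_eventuallyEq (Eventually.of_forall fun z => ?_))
  exact outPos_add_outNeg hX hχ z k

lemma IsUnitWave.mean_normalCurrent_out {w : ℝ → ℂ} (hw : IsUnitWave w) (hη : 0 < η) (y : ℝ) :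
    mean (particle w) (normalCurrent (outPos X χ η) (outNeg X χ η) y) =
      (χ y : ℂ) ^ 2 * currentForm (pairing w (inMode η (X y)))
        (pairing w fun k : ℝ => -(I * k * (deriv X y : ℝ)) * inMode η (X y) k) ∧
    mean (antiparticle w) (normalCurrent (outPos X χ η) (outNeg X χ η) y) =
      -((χ y : ℂ) ^ 2 * currentForm (pairing w (inMode η (X y)))
        (pairing w fun k : ℝ => -(I * k * (deriv X y : ℝ)) * inMode η (X y) k)) := by
  have hp := isMode_outFactor_mul_proj hX hχ hη (Set.Ioi 0) y
  have hm := isMode_outFactor_mul_proj hX hχ hη (Set.Iic 0) y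
  have hcp : IsMode (outPos X χ η y) := by
    rw [funext (outPos_eq X χ η y)]
    exact hp.1
  have hcm : IsMode (outNeg X χ η y) := by
    rw [funext (outNeg_eq X χ η y)]
    exact hm.1
  have hdp := funext fun k => (hasDerivAt_outPos hX hχ (η := η) y k).deriv
  have hdm := funext fun k => (hasDerivAt_outNeg hX hχ (η := η) y k).deriv
  have hd : ∀ k, outFactor η (-k) * projDeriv (Set.Ioi 0) X χ (-k) y =
      conj (outFactor η k * projDeriv (Set.Iic 0) X χ k y) := fun k => by
    refine (hasDerivAt_outPos hX hχ (η := η) y (-k)).unique ?_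
    simp only [outPos_neg]
    exact (hasDerivAt_outNeg hX hχ y k).star
  have r1 := mean_particle_normalCurrent hw.memLp hw.normalized hdp hdm hcp hcm hp.2 hm.2
    (outPos_neg X χ η y) hd
  have r2 := mean_antiparticle_normalCurrent hw.memLp hw.normalized hdp hdm hcp hcm hp.2 hm.2
    (outPos_neg X χ η y) hd
  have hint : ∀ {c : ℝ → ℂ}, IsMode c → Integrable (fun k => c k * w k) modeMeasure :=
    fun hc => hc.1.integrable_mul hw.memLp
  have hi := hint (isMode_inMode hη (X y))
  have hi' := hint (isMode_mul_inMode hη (X y) (deriv X y))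
  have e1 : pairing w (outPos X χ η y) + pairing w (outNeg X χ η y) =
      χ y * pairing w (inMode η (X y)) := by
    unfold pairing
    rw [← integral_add (hint hcp) (hint hcm), ← integral_const_mul]
    simp only [← add_mul, outPos_add_outNeg hX hχ, mul_assoc]
  have e2 : pairing w (fun k => outFactor η k * projDeriv (Set.Ioi 0) X χ k y) +
      pairing w (fun k => outFactor η k * projDeriv (Set.Iic 0) X χ k y) =
      (deriv χ y : ℝ) * pairing w (inMode η (X y)) +
        χ y * pairing w fun k : ℝ => -(I * k * (deriv X y : ℝ)) * inMode η (X y) k := by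
    unfold pairing
    rw [← integral_add (hint hp.2) (hint hm.2), ← integral_const_mul, ← integral_const_mul,
      ← integral_add (hi.const_mul _) (hi'.const_mul _)]
    simp only [← add_mul, deriv_outPos_add_deriv_outNeg hX hχ, ← mul_assoc]
  -- The term with the derivative of `χ` is a real multiple of the field amplitude itself, so the
  -- antisymmetric form annihilates it.
  have e3 : ∀ a b : ℂ, ∀ r s : ℝ, currentForm (r * a) (s * a + r * b) =
      (r : ℂ) ^ 2 * currentForm a b := fun a b r s => by
    simp only [currentForm, map_mul, map_add, conj_ofReal]
    ring
  rw [e1, e2, e3] at r1 r2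
  exact ⟨r1, r2⟩

end

lemma IsUnitWave.tendsto_cutoff_mul_currentForm {w : ℝ → ℂ} (hw : IsUnitWave w) (x X' y : ℝ)
    {χ : ℝ → ℝ} (hχ : Continuous χ) (h0 : χ 0 = 1) :
    Tendsto (fun q : ℝ × ℝ => (χ (q.2 * y) : ℂ) ^ 2 * currentForm (pairing w (inMode q.1 x))
      (pairing w fun k : ℝ => -(I * k * X') * inMode q.1 x k))
      ((𝓝[>] 0) ×ˢ (𝓝[>] 0)) (𝓝 (X' * density w x)) := by
  have ht : Tendsto (fun δ : ℝ => (χ (δ * y) : ℂ) ^ 2) (𝓝[>] 0) (𝓝 1) := by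
    have hc : Continuous fun δ : ℝ => (χ (δ * y) : ℂ) ^ 2 := by fun_prop
    simpa [h0] using (hc.tendsto 0).mono_left (nhdsWithin_le_nhds (s := Set.Ioi 0))
  have h := (ht.comp (tendsto_snd (f := 𝓝[>] (0 : ℝ)))).mul
    (hw.tendsto_currentForm_inMode (tendsto_fst (g := 𝓝[>] (0 : ℝ))) x x X')
  rw [one_mul] at h
  exact h

lemma IsBump.comp_mul_left {χ : ℝ → ℝ} (h1 : ContDiff ℝ ∞ χ) (h2 : HasCompactSupport χ) {δ : ℝ}
    (hδ : 0 < δ) : IsBump fun z => χ (δ * z) :=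
  ⟨h1.comp (contDiff_const.mul contDiff_id), by
    have h := h2.comp_homeomorph (Homeomorph.mulLeft₀ δ hδ.ne')
    exact h⟩

/-- The spatial cut-off enters only through `χ(δ y) ^ 2` and the mode cut-off only through `F`. The
mean value factorizes, so the two limits can be taken independently. -/
lemma hasOutCurrent_normalOrdering_of_eq {X : ℝ → ℝ} {Ψ : FockVec} {y : ℝ} {J : ℂ}
    {F : ℝ → ℂ} (h : ∀ χ : ℝ → ℝ, IsBump χ → ∀ η, 0 < η →
      mean Ψ (normalCurrent (outPos X χ η) (outNeg X χ η) y) = (χ y : ℂ) ^ 2 * F η)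
    (hF : ∀ χ : ℝ → ℝ, Continuous χ → χ 0 = 1 →
      Tendsto (fun q : ℝ × ℝ => (χ (q.2 * y) : ℂ) ^ 2 * F q.1) ((𝓝[>] 0) ×ˢ (𝓝[>] 0)) (𝓝 J)) :
    HasOutCurrent .normalOrdering X Ψ y J := by
  intro χ h1 h2 h3
  have hpos : ∀ᶠ δ : ℝ in 𝓝[>] 0, 0 < δ := self_mem_nhdsWithin
  refine (hF χ h1.continuous h3).congr' ?_
  filter_upwards [hpos.prod_mk hpos] with q hq
  exact (h _ (IsBump.comp_mul_left h1 h2 hq.2) q.1 hq.1).symm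

lemma IsUnitWave.hasOutCurrent_normalOrdering {w : ℝ → ℂ} (hw : IsUnitWave w) {X : ℝ → ℝ}
    (hX : IsCoordChange X) (y : ℝ) :
    HasOutCurrent .normalOrdering X (particle w) y (deriv X y * density w (X y)) ∧
      HasOutCurrent .normalOrdering X (antiparticle w) y (-(deriv X y * density w (X y))) := by
  constructor
  · exact hasOutCurrent_normalOrdering_of_eq
      (fun χ hχ η hη => (hw.mean_normalCurrent_out hX.1 hχ hη y).1)
      fun χ hχ h0 => hw.tendsto_cutoff_mul_currentForm _ _ _ hχ h0
  · refine hasOutCurrent_normalOrdering_of_eq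
      (fun χ hχ η hη => ((hw.mean_normalCurrent_out hX.1 hχ hη y).2.trans (mul_neg _ _).symm))
      fun χ hχ h0 => ?_
    simpa only [mul_neg] using (hw.tendsto_cutoff_mul_currentForm _ _ _ hχ h0).neg

lemma IsUnitWave.hasOutCurrent {w : ℝ → ℂ} (hw : IsUnitWave w) (s : Scheme) {X : ℝ → ℝ}
    (hX : IsCoordChange X) (y : ℝ) :
    HasOutCurrent s X (particle w) y (deriv X y * density w (X y)) ∧
      HasOutCurrent s X (antiparticle w) y (-(deriv X y * density w (X y))) := by
  cases s
  exacts [hw.hasOutCurrent_normalOrdering hX y, hw.hasOutCurrent_subtraction hX y]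

/-! ### A state with negative outgoing charge

The waves `∫_0^∞ exp(-ikx) (1 + 2k) exp(-k) dk` have the current density
`(15 - x²) / (1 + x²)³`, up to a positive factor, which is negative at large distances. They are
approximated by waves whose momentum space wave functions are smooth and vanish near `0` and
near `∞`. -/

/-- Smooth functions with compact support in `(0, ∞)` which tend to `1` there. -/
def window (n : ℕ) (k : ℝ) : ℝ :=
  Real.smoothTransition ((n + 1) * k - 1) * Real.smoothTransition (n + 2 - k)

lemma window_nonneg (n : ℕ) (k : ℝ) : 0 ≤ window n k :=
  mul_nonneg (Real.smoothTransition.nonneg _) (Real.smoothTransition.nonneg _)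

lemma window_le_one (n : ℕ) (k : ℝ) : window n k ≤ 1 :=
  mul_le_one₀ (Real.smoothTransition.le_one _) (Real.smoothTransition.nonneg _)
    (Real.smoothTransition.le_one _)

lemma window_of_nonpos (n : ℕ) {k : ℝ} (hk : k ≤ 0) : window n k = 0 := by
  have : ((n : ℝ) + 1) * k ≤ 0 := mul_nonpos_of_nonneg_of_nonpos (by positivity) hk
  rw [window, Real.smoothTransition.zero_of_nonpos (by linarith), zero_mul]

lemma window_of_ge (n : ℕ) {k : ℝ} (hk : n + 2 ≤ k) : window n k = 0 := by
  rw [window, Real.smoothTransition.zero_of_nonpos (x := (n : ℝ) + 2 - k) (by linarith), mul_zero]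

lemma contDiff_window (n : ℕ) : ContDiff ℝ ∞ (window n) := by
  have h : ContDiff ℝ ∞ Real.smoothTransition := Real.smoothTransition.contDiff
  exact (h.comp (by fun_prop)).mul (h.comp (by fun_prop))

lemma hasCompactSupport_window (n : ℕ) : HasCompactSupport (window n) :=
  HasCompactSupport.intro (isCompact_Icc (a := (0 : ℝ)) (b := n + 2)) fun k hk => by
    by_cases h0 : k ≤ 0
    · exact window_of_nonpos n h0
    · exact window_of_ge n (le_of_not_ge fun h => hk ⟨(not_le.1 h0).le, h⟩)

lemma tendsto_window {k : ℝ} (hk : 0 < k) : Tendsto (fun n => window n k) atTop (𝓝 1) := by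
  refine tendsto_const_nhds.congr' ?_
  have h1 : ∀ᶠ n : ℕ in atTop, 2 / k ≤ n := tendsto_natCast_atTop_atTop.eventually_ge_atTop _
  have h2 : ∀ᶠ n : ℕ in atTop, k ≤ n := tendsto_natCast_atTop_atTop.eventually_ge_atTop _
  filter_upwards [h1, h2] with n hn1 hn2
  rw [div_le_iff₀ hk] at hn1
  rw [window, Real.smoothTransition.one_of_one_le (by linarith),
    Real.smoothTransition.one_of_one_le (by linarith), mul_one]

/-- The wave with the momentum space amplitude `ρ`, restricted by `window n`. -/
def windowWave (n : ℕ) (ρ : ℝ → ℝ) (x : ℝ) : ℂ :=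
  ∫ k in Set.Ioi (0 : ℝ), exp (-(I * k * x)) * (window n k * ρ k : ℝ)

lemma tendsto_windowWave {ρ : ℝ → ℝ} (hc : Continuous ρ) (hρ : IntegrableOn ρ (Set.Ioi 0))
    (x : ℝ) : Tendsto (fun n => windowWave n ρ x) atTop
      (𝓝 (∫ k in Set.Ioi (0 : ℝ), exp (-(I * k * x)) * (ρ k : ℝ))) := by
  refine tendsto_integral_of_dominated_convergence (fun k => ‖ρ k‖) (fun n => ?_) hρ.norm
    (fun n => ae_of_all _ fun k => ?_)
    ((ae_restrict_iff' measurableSet_Ioi).2 (ae_of_all _ fun k hk => ?_))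
  · have := (contDiff_window n).continuous
    fun_prop
  · rw [norm_mul, norm_exp_phase, one_mul, norm_real, norm_mul,
      Real.norm_of_nonneg (window_nonneg n k)]
    exact mul_le_of_le_one_left (norm_nonneg _) (window_le_one n k)
  · have h := (continuous_ofReal.tendsto _).comp ((tendsto_window hk).mul_const (ρ k))
    rw [one_mul] at h
    exact h.const_mul _

/-- Decay of `windowWave` at infinity, uniformly in the window. -/
lemma abs_mul_norm_windowWave_le {ρ ρ' : ℝ → ℝ} (hd : ∀ k, HasDerivAt ρ (ρ' k) k)
    (hc : Continuous ρ') {M : ℝ} (hM : ∀ k, 0 ≤ k → |ρ k| ≤ M)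
    (hi : IntegrableOn ρ' (Set.Ioi 0)) (n : ℕ) (x : ℝ) :
    |x| * ‖windowWave n ρ x‖ ≤ 2 * M + ∫ k in Set.Ioi (0 : ℝ), |ρ' k| := by
  set R : ℝ := n + 2 with hR
  have hR0 : 0 ≤ R := by positivity
  have hM0 : 0 ≤ M := (abs_nonneg _).trans (hM 0 le_rfl)
  set α : ℝ → ℝ := fun k => Real.smoothTransition ((n + 1) * k - 1) with hα
  set β : ℝ → ℝ := fun k => Real.smoothTransition (n + 2 - k) with hβ
  have hs : ContDiff ℝ ∞ Real.smoothTransition := Real.smoothTransition.contDiff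
  have hαs : ContDiff ℝ ∞ α := hs.comp (by fun_prop)
  have hβs : ContDiff ℝ ∞ β := hs.comp (by fun_prop)
  have hαd : ∀ k, HasDerivAt α (deriv α k) k := fun k =>
    (hαs.differentiable (by simp) k).hasDerivAt
  have hβd : ∀ k, HasDerivAt β (deriv β k) k := fun k =>
    (hβs.differentiable (by simp) k).hasDerivAt
  have hαc : Continuous (deriv α) := hαs.continuous_deriv (by simp)
  have hβc : Continuous (deriv β) := hβs.continuous_deriv (by simp)
  -- Monotonicity of the two flanks is what makes the bound uniform in `n`: the derivative of `α`
  -- may grow with `n`, but the total variation of each flank is at most `1`.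
  have hα0 : ∀ k, 0 ≤ deriv α k := fun k => by
    refine Monotone.deriv_nonneg fun a b hab => Real.smoothTransition.monotone ?_
    have : ((n : ℝ) + 1) * a ≤ (n + 1) * b := by gcongr
    linarith
  have hβ0 : ∀ k, deriv β k ≤ 0 := fun k =>
    Antitone.deriv_nonpos fun a b hab => Real.smoothTransition.monotone (by linarith)
  have hα1 : ∀ k, |α k| ≤ 1 := fun k => by
    rw [abs_of_nonneg (Real.smoothTransition.nonneg _)]
    exact Real.smoothTransition.le_one _
  have hβ1 : ∀ k, |β k| ≤ 1 := fun k => by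
    rw [abs_of_nonneg (Real.smoothTransition.nonneg _)]
    exact Real.smoothTransition.le_one _
  have hρc : Continuous ρ := continuous_iff_continuousAt.2 fun k => (hd k).continuousAt
  set f : ℝ → ℝ := fun k => window n k * ρ k with hf
  set f' : ℝ → ℝ := fun k =>
    (deriv α k * β k + α k * deriv β k) * ρ k + α k * β k * ρ' k with hf'
  have hfd : ∀ k, HasDerivAt f (f' k) k := fun k => ((hαd k).mul (hβd k)).mul (hd k)
  have hf'c : Continuous f' := by
    have := hαs.continuous
    have := hβs.continuous
    fun_prop
  have hf0 : f 0 = 0 := by simp [hf, window_of_nonpos n le_rfl]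
  have hfR : f R = 0 := by simp [hf, window_of_ge n le_rfl, hR]
  have hw : windowWave n ρ x = ∫ k in (0 : ℝ)..R, exp (-(I * k * x)) * (f k : ℂ) := by
    rw [windowWave, intervalIntegral.integral_of_le hR0]
    refine setIntegral_eq_of_subset_of_forall_sdiff_eq_zero (s := Set.Ioc 0 R)
      (t := Set.Ioi (0 : ℝ)) measurableSet_Ioi Set.Ioc_subset_Ioi_self fun k hk => ?_
    have : R ≤ k := le_of_not_ge fun h => hk.2 ⟨hk.1, h⟩
    simp [window_of_ge n this]
  -- Integration by parts has no boundary terms, since the window vanishes at `0` and at `R = n +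
  -- 2`.
  have hparts : I * x * windowWave n ρ x = ∫ k in (0 : ℝ)..R, exp (-(I * k * x)) * (f' k : ℂ) := by
    have hu : ∀ k : ℝ, HasDerivAt (fun k : ℝ => exp (-(I * k * x)))
        (-(I * x) * exp (-(I * k * x))) k := fun k => by
      have h1 := (((((hasDerivAt_id k).ofReal_comp).const_mul I).mul_const (x : ℂ)).neg).cexp
      refine h1.congr_deriv ?_
      simp only [Pi.neg_apply, id, ofReal_one]
      ring
    have h := intervalIntegral.integral_mul_deriv_eq_deriv_mul (a := 0) (b := R)
      (fun k _ => hu k) (fun k _ => (hfd k).ofReal_comp)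
      (Continuous.intervalIntegrable (by fun_prop) _ _)
      (Continuous.intervalIntegrable (by fun_prop) _ _)
    rw [h, hf0, hfR, hw, ← intervalIntegral.integral_const_mul]
    simp only [ofReal_zero, mul_zero, sub_zero, zero_sub, ← intervalIntegral.integral_neg]
    congr 1
    funext k
    ring
  have hbound : ∀ k ∈ Set.Icc 0 R, |f' k| ≤ M * deriv α k + M * -deriv β k + |ρ' k| := by
    intro k hk
    have h1 : |(deriv α k * β k + α k * deriv β k) * ρ k| ≤
        (deriv α k * 1 + 1 * -deriv β k) * M := by
      rw [abs_mul]
      refine mul_le_mul ((abs_add_le _ _).trans ?_) (hM k hk.1) (abs_nonneg _) ?_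
      · rw [abs_mul, abs_mul, abs_of_nonneg (hα0 k), abs_of_nonpos (hβ0 k)]
        exact add_le_add (mul_le_mul_of_nonneg_left (hβ1 k) (hα0 k))
          (mul_le_mul_of_nonneg_right (hα1 k) (neg_nonneg.2 (hβ0 k)))
      · have := hα0 k
        have := hβ0 k
        linarith
    have h2 : |α k * β k * ρ' k| ≤ 1 * 1 * |ρ' k| := by
      rw [abs_mul, abs_mul]
      gcongr
      exacts [hα1 k, hβ1 k]
    calc |f' k| ≤ _ := abs_add_le _ _
      _ ≤ _ := add_le_add h1 h2
      _ = _ := by ring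
  have hρ'i : ∫ k in (0 : ℝ)..R, |ρ' k| ≤ ∫ k in Set.Ioi (0 : ℝ), |ρ' k| := by
    rw [intervalIntegral.integral_of_le hR0]
    exact setIntegral_mono_set hi.abs (ae_of_all _ fun _ => abs_nonneg _)
      (ae_of_all _ Set.Ioc_subset_Ioi_self)
  have hαi : ∫ k in (0 : ℝ)..R, deriv α k = α R - α 0 :=
    intervalIntegral.integral_eq_sub_of_hasDerivAt (fun k _ => hαd k) (hαc.intervalIntegrable _ _)
  have hβi : ∫ k in (0 : ℝ)..R, deriv β k = β R - β 0 :=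
    intervalIntegral.integral_eq_sub_of_hasDerivAt (fun k _ => hβd k) (hβc.intervalIntegrable _ _)
  have hαR := (abs_le.1 (hα1 R)).2
  have hβ00 := (abs_le.1 (hβ1 0)).2
  have hα00 : 0 ≤ α 0 := Real.smoothTransition.nonneg _
  have hβR : 0 ≤ β R := Real.smoothTransition.nonneg _
  calc |x| * ‖windowWave n ρ x‖ = ‖I * x * windowWave n ρ x‖ := by
        rw [norm_mul, norm_mul, norm_I, one_mul, norm_real, Real.norm_eq_abs]
    _ ≤ ∫ k in (0 : ℝ)..R, |f' k| := by
        rw [hparts]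
        refine (intervalIntegral.norm_integral_le_integral_norm hR0).trans (le_of_eq ?_)
        simp only [norm_mul, norm_exp_phase, one_mul, norm_real, Real.norm_eq_abs]
    _ ≤ ∫ k in (0 : ℝ)..R, (M * deriv α k + M * -deriv β k + |ρ' k|) :=
        intervalIntegral.integral_mono_on hR0 (hf'c.abs.intervalIntegrable _ _)
          (Continuous.intervalIntegrable (by fun_prop) _ _) hbound
    _ = M * (α R - α 0) + M * (β 0 - β R) + ∫ k in (0 : ℝ)..R, |ρ' k| := by
        rw [intervalIntegral.integral_add (Continuous.intervalIntegrable (by fun_prop) _ _)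
          (hc.abs.intervalIntegrable _ _),
          intervalIntegral.integral_add (Continuous.intervalIntegrable (by fun_prop) _ _)
          (Continuous.intervalIntegrable (by fun_prop) _ _),
          intervalIntegral.integral_const_mul, intervalIntegral.integral_const_mul,
          intervalIntegral.integral_neg, hαi, hβi]
        ring
    _ ≤ M * 1 + M * 1 + ∫ k in Set.Ioi (0 : ℝ), |ρ' k| := by
        gcongr <;> linarith
    _ = _ := by ring

/-! ### The limiting amplitude and its current density. -/

lemma integrableOn_pow_mul_exp_neg (m : ℕ) :
    IntegrableOn (fun k : ℝ => k ^ m * Real.exp (-k)) (Set.Ioi 0) := by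
  have h := Real.GammaIntegral_convergent (s := m + 1) (by positivity)
  refine h.congr_fun (fun k hk => ?_) measurableSet_Ioi
  simp only [add_sub_cancel_right, Real.rpow_natCast]
  ring

/-- The wave with momentum space amplitude `k ^ m * exp (-k)`, up to a factor. -/
def powWave (m : ℕ) (x : ℝ) : ℂ :=
  ∫ k in Set.Ioi (0 : ℝ), exp (-(I * k * x)) * (k ^ m * Real.exp (-k) : ℝ)

lemma integrableOn_powWave (m : ℕ) (x : ℝ) :
    IntegrableOn (fun k : ℝ => exp (-(I * k * x)) * (k ^ m * Real.exp (-k) : ℝ)) (Set.Ioi 0) := by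
  refine (integrableOn_pow_mul_exp_neg m).ofReal.bdd_mul (c := 1) (by fun_prop)
    (ae_of_all _ fun k => ?_)
  rw [norm_exp_phase]

lemma one_add_I_mul_ne_zero (x : ℝ) : (1 + I * x : ℂ) ≠ 0 := by
  intro h
  simpa using congrArg re h

lemma powWave_zero (x : ℝ) : powWave 0 x = 1 / (1 + I * x) := by
  have h := integral_exp_mul_complex_Ioi (a := -(1 + I * x)) (by simp) 0
  rw [ofReal_zero, mul_zero, exp_zero, neg_div_neg_eq] at h
  rw [powWave, ← h]
  refine setIntegral_congr_fun measurableSet_Ioi fun k _ => ?_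
  simp only [pow_zero, one_mul, ofReal_exp, ← exp_add]
  congr 1
  push_cast
  ring

/-- The derivative of `k ^ (m + 1) exp (-k) exp (-ikx)` integrates to zero over the half-line,
because the function vanishes at both ends. -/
lemma powWave_succ (m : ℕ) (x : ℝ) :
    powWave (m + 1) x = (m + 1) / (1 + I * x) * powWave m x := by
  have hd : ∀ k : ℝ, HasDerivAt
      (fun k : ℝ => exp (-(I * k * x)) * (k ^ (m + 1) * Real.exp (-k) : ℝ))
      ((m + 1) * (exp (-(I * k * x)) * (k ^ m * Real.exp (-k) : ℝ)) -
        (1 + I * x) * (exp (-(I * k * x)) * (k ^ (m + 1) * Real.exp (-k) : ℝ))) k := fun k => by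
    have h1 := (((((hasDerivAt_id k).ofReal_comp).const_mul I).mul_const (x : ℂ)).neg).cexp
    have h2 := ((hasDerivAt_pow (m + 1) k).mul (hasDerivAt_id k).neg.exp).ofReal_comp
    refine (h1.mul h2).congr_deriv ?_
    simp only [Pi.neg_apply, id, ofReal_one, Pi.mul_apply]
    push_cast
    ring
  have hi := integrableOn_powWave m x
  have hi' := integrableOn_powWave (m + 1) x
  have ht : Tendsto (fun k : ℝ => exp (-(I * k * x)) * (k ^ (m + 1) * Real.exp (-k) : ℝ))
      atTop (𝓝 0) := by
    rw [tendsto_zero_iff_norm_tendsto_zero]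
    simp only [norm_mul, norm_exp_phase, one_mul, norm_real]
    have := (Real.tendsto_pow_mul_exp_neg_atTop_nhds_zero (m + 1)).norm
    simpa using this
  have h := integral_Ioi_of_hasDerivAt_of_tendsto (a := 0) (hd 0).continuousAt.continuousWithinAt
    (fun k _ => hd k) ((hi.const_mul _).sub (hi'.const_mul _)) ht
  rw [integral_sub (hi.const_mul _) (hi'.const_mul _), integral_const_mul, integral_const_mul] at h
  have h' : (m + 1) * powWave m x = (1 + I * x) * powWave (m + 1) x := by
    rw [← sub_eq_zero]
    refine h.trans ?_
    simp
  rw [div_mul_eq_mul_div, h', mul_div_cancel_left₀ _ (one_add_I_mul_ne_zero x)]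

/-- The momentum space amplitude of the wave, and that of its derivative. -/
def ampl (k : ℝ) : ℝ := k ^ 0 * Real.exp (-k) + 2 * (k ^ 1 * Real.exp (-k))

lemma continuous_ampl : Continuous ampl := by
  unfold ampl
  fun_prop

lemma integral_ampl (x : ℝ) : ∫ k in Set.Ioi (0 : ℝ), exp (-(I * k * x)) * (ampl k : ℝ) =
    1 / (1 + I * x) + 2 / (1 + I * x) ^ 2 := by
  have h : ∀ k : ℝ, exp (-(I * k * x)) * (ampl k : ℝ) =
      exp (-(I * k * x)) * (k ^ 0 * Real.exp (-k) : ℝ) +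
        2 * (exp (-(I * k * x)) * (k ^ 1 * Real.exp (-k) : ℝ)) := fun k => by
    rw [ampl]; push_cast; ring
  simp only [h]
  rw [integral_add (integrableOn_powWave 0 x) ((integrableOn_powWave 1 x).const_mul 2),
    integral_const_mul]
  change powWave 0 x + 2 * powWave (0 + 1) x = _
  rw [powWave_succ, powWave_zero]
  have := one_add_I_mul_ne_zero x
  push_cast
  field_simp
  ring

lemma integral_mul_ampl (x : ℝ) :
    ∫ k in Set.Ioi (0 : ℝ), exp (-(I * k * x)) * (k * ampl k : ℝ) =
      1 / (1 + I * x) ^ 2 + 4 / (1 + I * x) ^ 3 := by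
  have h : ∀ k : ℝ, exp (-(I * k * x)) * (k * ampl k : ℝ) =
      exp (-(I * k * x)) * (k ^ 1 * Real.exp (-k) : ℝ) +
        2 * (exp (-(I * k * x)) * (k ^ 2 * Real.exp (-k) : ℝ)) := fun k => by
    rw [ampl]; push_cast; ring
  simp only [h]
  rw [integral_add (integrableOn_powWave 1 x) ((integrableOn_powWave 2 x).const_mul 2),
    integral_const_mul]
  have h1 := powWave_succ 0 x
  have h2 := powWave_succ 1 x
  rw [zero_add, powWave_zero] at h1
  rw [one_add_one_eq_two, h1] at h2
  change powWave 1 x + 2 * powWave 2 x = _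
  rw [h2, h1]
  have := one_add_I_mul_ne_zero x
  push_cast
  field_simp
  ring

/-- For an amplitude `(1 + ck) exp (-k)` the numerator would be `1 + 3c + 2c² + (1 - c) x²`, which
becomes negative far out exactly when `c > 1`; here `c = 2`. -/
lemma re_conj_mul_limit (x : ℝ) :
    (conj (1 / (1 + I * x) + 2 / (1 + I * x) ^ 2 : ℂ) *
      (1 / (1 + I * x) ^ 2 + 4 / (1 + I * x) ^ 3)).re = (15 - x ^ 2) / (1 + x ^ 2) ^ 3 := by
  have h1 := one_add_I_mul_ne_zero x
  have h2 : (1 - I * x : ℂ) ≠ 0 := by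
    intro h
    simpa using congrArg re h
  have h3 : (1 + I * x : ℂ) * (1 - I * x) = ((1 + x ^ 2 : ℝ) : ℂ) := by
    push_cast
    ring_nf
    rw [I_sq]
    ring
  have hx : ((1 + x ^ 2 : ℝ) : ℂ) ≠ 0 := by rw [← h3]; exact mul_ne_zero h1 h2
  have key : conj (1 / (1 + I * x) + 2 / (1 + I * x) ^ 2 : ℂ) *
      (1 / (1 + I * x) ^ 2 + 4 / (1 + I * x) ^ 3) =
      (((15 - x ^ 2) / (1 + x ^ 2) ^ 3 : ℝ) : ℂ) +
        (((-17 * x - x ^ 3) / (1 + x ^ 2) ^ 3 : ℝ) : ℂ) * I := by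
    simp only [map_add, map_div₀, map_pow, map_mul, map_one, map_ofNat, conj_I, conj_ofReal]
    rw [show (1 + -I * x : ℂ) = 1 - I * x by ring, ofReal_div, ofReal_div, ofReal_pow, ← h3]
    field_simp
    push_cast
    ring_nf
    simp only [I_sq, show I ^ 3 = -I by rw [pow_succ, I_sq]; ring]
    ring
  rw [key, add_re, ofReal_re, re_ofReal_mul, I_re, mul_zero, add_zero]

lemma hasDerivAt_pow_mul_exp_neg (m : ℕ) (k : ℝ) :
    HasDerivAt (fun k : ℝ => k ^ m * Real.exp (-k))
      (m * k ^ (m - 1) * Real.exp (-k) - k ^ m * Real.exp (-k)) k := by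
  refine ((hasDerivAt_pow m k).mul (hasDerivAt_id k).neg.exp).congr_deriv ?_
  simp only [Pi.neg_apply, id]
  ring

lemma hasDerivAt_ampl (k : ℝ) : HasDerivAt ampl
    (k ^ 0 * Real.exp (-k) - 2 * (k ^ 1 * Real.exp (-k))) k := by
  refine ((hasDerivAt_pow_mul_exp_neg 0 k).add
    ((hasDerivAt_pow_mul_exp_neg 1 k).const_mul 2)).congr_deriv ?_
  push_cast
  ring

lemma hasDerivAt_mul_ampl (k : ℝ) : HasDerivAt (fun k => k * ampl k)
    (k ^ 0 * Real.exp (-k) + 3 * (k ^ 1 * Real.exp (-k)) - 2 * (k ^ 2 * Real.exp (-k))) k := by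
  refine ((hasDerivAt_id k).mul (hasDerivAt_ampl k)).congr_deriv ?_
  simp only [id, ampl]
  ring

lemma integrableOn_ampl : IntegrableOn ampl (Set.Ioi 0) :=
  (integrableOn_pow_mul_exp_neg 0).add ((integrableOn_pow_mul_exp_neg 1).const_mul 2)

lemma integrableOn_mul_ampl : IntegrableOn (fun k => k * ampl k) (Set.Ioi 0) := by
  refine ((integrableOn_pow_mul_exp_neg 1).add
    ((integrableOn_pow_mul_exp_neg 2).const_mul 2)).congr (ae_of_all _ fun k => ?_)
  simp only [Pi.add_apply, ampl]
  ring

lemma pow_mul_exp_neg_le (m : ℕ) {k : ℝ} (hk : 0 ≤ k) :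
    k ^ m * Real.exp (-k) ≤ m.factorial := by
  have h := Real.pow_div_factorial_le_exp k hk m
  have hm : (0 : ℝ) < m.factorial := by positivity
  rw [div_le_iff₀ hm] at h
  calc k ^ m * Real.exp (-k) ≤ Real.exp k * m.factorial * Real.exp (-k) := by gcongr
    _ = m.factorial * (Real.exp k * Real.exp (-k)) := by ring
    _ = m.factorial := by rw [← Real.exp_add, add_neg_cancel, Real.exp_zero, mul_one]

/-- The currents of the approximating waves are dominated uniformly. -/
lemma exists_norm_windowWave_mul_le : ∃ C, ∀ (n : ℕ) (x : ℝ),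
    x ^ 2 * (‖windowWave n ampl x‖ * ‖windowWave n (fun k => k * ampl k) x‖) ≤ C := by
  have h0 : ∀ k : ℝ, 0 ≤ k → 0 ≤ ampl k := fun k hk => by
    unfold ampl
    positivity
  -- Since `k ^ m exp (-k) ≤ m!`, the bounds are `3 = 0! + 2 · 1!` here and `5 = 1! + 2 · 2!` for `k
  -- * ampl k`. Each factor decays like `1/|x|`, the product like `1/x²`.
  have h1 := abs_mul_norm_windowWave_le hasDerivAt_ampl (by fun_prop) (M := 3)
    (fun k hk => by
      rw [abs_of_nonneg (h0 k hk), ampl]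
      have a := pow_mul_exp_neg_le 0 hk
      have b := pow_mul_exp_neg_le 1 hk
      rw [Nat.factorial_zero, Nat.cast_one] at a
      rw [Nat.factorial_one, Nat.cast_one] at b
      linarith)
    ((integrableOn_pow_mul_exp_neg 0).sub ((integrableOn_pow_mul_exp_neg 1).const_mul 2))
  have h2 := abs_mul_norm_windowWave_le hasDerivAt_mul_ampl (by fun_prop) (M := 5)
    (fun k hk => by
      rw [abs_of_nonneg (mul_nonneg hk (h0 k hk)), ampl]
      have a := pow_mul_exp_neg_le 1 hk
      have b := pow_mul_exp_neg_le 2 hk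
      norm_num [Nat.factorial] at a b ⊢
      nlinarith)
    (((integrableOn_pow_mul_exp_neg 0).add ((integrableOn_pow_mul_exp_neg 1).const_mul 3)).sub
      ((integrableOn_pow_mul_exp_neg 2).const_mul 2))
  refine ⟨_, fun n x => le_trans (le_of_eq ?_) (mul_le_mul (h1 n x) (h2 n x) (by positivity)
    (le_trans (by positivity) (h1 n x)))⟩
  rw [← sq_abs]
  ring

/-- The current density, up to a factor, of the approximating waves. -/
def windowDensity (n : ℕ) (x : ℝ) : ℝ :=
  (conj (windowWave n ampl x) * windowWave n (fun k => k * ampl k) x).re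

lemma integrableOn_inv_sq : IntegrableOn (fun x : ℝ => ((x - 4) ^ 2)⁻¹) (Set.Iio 0) := by
  refine Integrable.mono' (g := fun x : ℝ => (1 + x ^ 2)⁻¹)
    integrable_inv_one_add_sq.integrableOn
    (Measurable.aestronglyMeasurable (by fun_prop))
    ((ae_restrict_iff' measurableSet_Iio).2 (ae_of_all _ fun x hx => ?_))
  have hx : x < 0 := hx
  rw [Real.norm_of_nonneg (by positivity)]
  refine inv_anti₀ (by positivity) ?_
  nlinarith

lemma measurable_windowWave (n : ℕ) {ρ : ℝ → ℝ} (hc : Continuous ρ) :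
    Measurable (windowWave n ρ) := by
  have := (contDiff_window n).continuous
  exact (StronglyMeasurable.integral_prod_right' (ν := volume.restrict (Set.Ioi (0 : ℝ)))
    (f := fun q : ℝ × ℝ => exp (-(I * q.2 * q.1)) * (window n q.2 * ρ q.2 : ℝ))
    (Continuous.stronglyMeasurable (by fun_prop))).measurable

/-- The translation by 4 keeps the majorant `C / (x - 4)²` away from its singularity on `x < 0`. -/
lemma tendsto_integral_windowDensity :
    Tendsto (fun n => ∫ x in Set.Iio (0 : ℝ), windowDensity n (x - 4)) atTop
      (𝓝 (∫ x in Set.Iio (0 : ℝ), (15 - (x - 4) ^ 2) / (1 + (x - 4) ^ 2) ^ 3)) := by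
  obtain ⟨C, hC⟩ := exists_norm_windowWave_mul_le
  have hc := continuous_ampl
  refine tendsto_integral_of_dominated_convergence (fun x : ℝ => C * ((x - 4) ^ 2)⁻¹)
    (fun n => ?_) (integrableOn_inv_sq.const_mul C)
    (fun n => (ae_restrict_iff' measurableSet_Iio).2 (ae_of_all _ fun x hx => ?_))
    (ae_of_all _ fun x => ?_)
  · have h1 := measurable_windowWave n hc
    have h2 := measurable_windowWave n (ρ := fun k => k * ampl k) (by fun_prop)
    exact Measurable.aestronglyMeasurable (by unfold windowDensity; fun_prop)
  · have hx : x < 0 := hx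
    have hx2 : 0 < (x - 4) ^ 2 := by nlinarith
    rw [← div_eq_mul_inv, le_div_iff₀ hx2, mul_comm]
    refine le_trans (mul_le_mul_of_nonneg_left ?_ hx2.le) (hC n (x - 4))
    refine (abs_re_le_norm _).trans (le_of_eq ?_)
    rw [norm_mul, RCLike.norm_conj]
  · have h1 := tendsto_windowWave hc integrableOn_ampl (x - 4)
    have h2 := tendsto_windowWave (ρ := fun k => k * ampl k) (by fun_prop) integrableOn_mul_ampl
      (x - 4)
    rw [integral_ampl] at h1
    rw [integral_mul_ampl] at h2
    have h := (continuous_re.tendsto _).comp (((continuous_conj.tendsto _).comp h1).mul h2)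
    rw [re_conj_mul_limit] at h
    exact h

/-- For `x < 0` one has `(x - 4)² > 16 > 15`, so the integrand is strictly negative throughout. -/
lemma integral_limit_neg :
    ∫ x in Set.Iio (0 : ℝ), (15 - (x - 4) ^ 2) / (1 + (x - 4) ^ 2) ^ 3 < 0 := by
  have hneg : ∀ x ∈ Set.Iio (0 : ℝ), 0 < -((15 - (x - 4) ^ 2) / (1 + (x - 4) ^ 2) ^ 3) :=
    fun x hx => by
      have hx : x < 0 := hx
      rw [← neg_div]
      refine div_pos ?_ (by positivity)
      nlinarith
  have hi : IntegrableOn (fun x : ℝ => -((15 - (x - 4) ^ 2) / (1 + (x - 4) ^ 2) ^ 3))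
      (Set.Iio 0) := by
    refine Integrable.mono' integrableOn_inv_sq (Measurable.aestronglyMeasurable (by fun_prop))
      ((ae_restrict_iff' measurableSet_Iio).2 (ae_of_all _ fun x hx => ?_))
    rw [Real.norm_of_nonneg (hneg x hx).le, ← neg_div]
    have hx : x < 0 := hx
    have hx2 : 0 < (x - 4) ^ 2 := by nlinarith
    rw [div_le_iff₀ (by positivity), ← div_eq_inv_mul, le_div_iff₀ hx2]
    nlinarith [pow_pos hx2 2, pow_pos hx2 3]
  have h := (setIntegral_pos_iff_support_of_nonneg_ae
    ((ae_restrict_iff' measurableSet_Iio).2 (ae_of_all _ fun x hx => (hneg x hx).le)) hi).2 (by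
      refine lt_of_lt_of_le ?_ (measure_mono (s := Set.Iio (0 : ℝ))
        fun x hx => ⟨(hneg x hx).ne', hx⟩)
      simp)
  rw [integral_neg] at h
  linarith

/-! ### Construction of the state -/

lemma exists_ft_eq (v : 𝓢(ℝ, ℂ)) : ∃ g : 𝓢(ℝ, ℂ), ∀ k, ft g k = v k := by
  have h2pi : (2 * Real.pi : ℝ) ≠ 0 := by positivity
  refine ⟨𝓕⁻ ((Real.sqrt (2 * Real.pi) : ℂ) • SchwartzMap.compCLMOfContinuousLinearEquiv ℂ
    (ContinuousLinearEquiv.unitsEquivAut ℝ (Units.mk0 _ h2pi)) v), fun k => ?_⟩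
  rw [ft_eq_fourier, ← SchwartzMap.fourier_coe, FourierTransform.fourier_fourierInv_eq]
  rw [smul_apply, SchwartzMap.compCLMOfContinuousLinearEquiv_apply, smul_eq_mul,
    ← mul_assoc, one_div_mul_cancel sqrt_two_pi_ne_zero, one_mul]
  simp [h2pi]

/-- The factor `2k` compensates the weight `1/(2k)`, and the phase `exp (-4ik)`, conjugated in the
wave function, translates the wave by 4. The window makes the right side smooth with compact
support. -/
lemma exists_window_state (n : ℕ) : ∃ g : 𝓢(ℝ, ℂ),
    ∀ k : ℝ, ft g k = 2 * k * (window n k * ampl k : ℝ) * exp (-(I * k * (4 : ℝ))) := by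
  have h1 : ContDiff ℝ ∞ fun k : ℝ =>
      (2 * k * (window n k * ampl k : ℝ) * exp (-(I * k * (4 : ℝ))) : ℂ) := by
    have h2 := contDiff_window n
    have h3 : ContDiff ℝ ∞ ampl := by
      unfold ampl
      fun_prop
    have h4 : ContDiff ℝ ∞ fun k : ℝ => (k : ℂ) := ofRealCLM.contDiff
    have h5 : ContDiff ℝ ∞ fun k : ℝ => ((window n k * ampl k : ℝ) : ℂ) := h4.comp (h2.mul h3)
    fun_prop
  have h2 : HasCompactSupport fun k : ℝ =>
      (2 * k * (window n k * ampl k : ℝ) * exp (-(I * k * (4 : ℝ))) : ℂ) := by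
    refine (hasCompactSupport_window n).mono' fun k hk => subset_tsupport _ fun h => hk ?_
    simp [h]
  obtain ⟨g, hg⟩ := exists_ft_eq (h2.toSchwartzMap h1)
  exact ⟨g, hg⟩

lemma exists_unnormalized_negative_charge : ∃ g : 𝓢(ℝ, ℂ), (∀ k : ℝ, k < 0 → ft g k = 0) ∧
    ∃ q : ℝ, q < 0 ∧ ∫ x in Set.Iio 0, density (testWave g) x = q := by
  obtain ⟨n, hn⟩ :=
    (tendsto_integral_windowDensity.eventually (gt_mem_nhds integral_limit_neg)).exists
  obtain ⟨g, hg⟩ := exists_window_state n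
  refine ⟨g, fun k hk => ?_, (1 / Real.pi) * ∫ x in Set.Iio (0 : ℝ), windowDensity n (x - 4),
    mul_neg_of_pos_of_neg (by positivity) hn, ?_⟩
  · rw [hg, window_of_nonpos n hk.le]
    simp
  have e : ∀ (x k : ℝ), k ∈ Set.Ioi (0 : ℝ) →
      (1 / (2 * k) : ℂ) * (exp (-(I * k * x)) * testWave g k) =
        exp (-(I * k * (x - 4 : ℝ))) * (window n k * ampl k : ℝ) := fun x k hk => by
    have hk : (k : ℂ) ≠ 0 := by exact_mod_cast (ne_of_gt hk)
    rw [testWave, hg]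
    simp only [map_mul, map_ofNat, conj_ofReal, ← exp_conj, map_neg, conj_I]
    rw [show -(I * (k : ℂ) * ((x - 4 : ℝ) : ℂ)) = -(I * k * x) + -(-I * k * (4 : ℝ)) by
      push_cast; ring, exp_add]
    field_simp
  have e1 : ∀ x, wave (testWave g) x =
      (1 / (Real.sqrt (2 * Real.pi) : ℂ)) * windowWave n ampl (x - 4) := fun x => by
    rw [wave, integral_modeMeasure, windowWave]
    congr 1
    exact setIntegral_congr_fun measurableSet_Ioi fun k hk => e x k hk
  have e2 : ∀ x, waveDeriv (testWave g) x = (1 / (Real.sqrt (2 * Real.pi) : ℂ)) *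
      (-I * windowWave n (fun k => k * ampl k) (x - 4)) := fun x => by
    rw [waveDeriv, integral_modeMeasure, windowWave, ← integral_const_mul (-I)]
    congr 1
    refine setIntegral_congr_fun measurableSet_Ioi fun k hk => ?_
    have := e x k hk
    calc _ = -(I * k) * ((1 / (2 * k) : ℂ) * (exp (-(I * k * x)) * testWave g k)) := by ring
      _ = _ := by rw [this]; push_cast; ring
  have e3 : ∀ x, density (testWave g) x = ((1 / Real.pi * windowDensity n (x - 4) : ℝ) : ℂ) := by
    intro x
    have hs : (1 / (Real.sqrt (2 * Real.pi) : ℂ)) * (1 / (Real.sqrt (2 * Real.pi) : ℂ)) =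
        1 / (2 * Real.pi) := by
      rw [← sqrt_two_pi_mul_self]
      field_simp
    have hpi : (Real.pi : ℂ) ≠ 0 := by exact_mod_cast Real.pi_ne_zero
    rw [density, e1, e2, windowDensity, ofReal_mul, re_eq_add_conj]
    generalize windowWave n ampl (x - 4) = A
    generalize windowWave n (fun k => k * ampl k) (x - 4) = B
    simp only [currentForm, map_mul, map_div₀, map_one, conj_ofReal, map_neg, conj_I, conj_conj]
    calc _ = (1 / (Real.sqrt (2 * Real.pi) : ℂ)) * (1 / (Real.sqrt (2 * Real.pi) : ℂ)) *
          (-(I ^ 2)) * (conj A * B + A * conj B) := by ring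
      _ = _ := by
        rw [hs, I_sq]
        push_cast
        field_simp
  simp only [e3]
  rw [integral_complex_ofReal, integral_const_mul]

lemma wave_ofReal_mul (r : ℝ) (w : ℝ → ℂ) (x : ℝ) :
    wave (fun k => r * w k) x = r * wave w x := by
  simp only [wave, mul_left_comm _ (r : ℂ), integral_const_mul]

lemma waveDeriv_ofReal_mul (r : ℝ) (w : ℝ → ℂ) (x : ℝ) :
    waveDeriv (fun k => r * w k) x = r * waveDeriv w x := by
  simp only [waveDeriv, mul_left_comm _ (r : ℂ), integral_const_mul]

lemma exists_negative_charge : ∃ g : 𝓢(ℝ, ℂ), IsNormalizedTest g ∧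
    ∃ q : ℝ, q < 0 ∧ ∫ x in Set.Iio 0, density (testWave g) x = q := by
  obtain ⟨g, hg, q, hq, hgq⟩ := exists_unnormalized_negative_charge
  have hw := isWave_testWave hg
  set N : ℝ := ∫ k, ‖ft g k‖ ^ 2 ∂modeMeasure with hN
  have hi : Integrable (fun k => ‖ft g k‖ ^ 2) modeMeasure := by
    have h := hw.memLp.integrable_norm_pow two_ne_zero
    simpa [testWave] using h
  -- A state of norm zero would have a vanishing wave and hence zero charge, contrary to `q < 0`.
  have hN0 : 0 < N := by
    refine lt_of_le_of_ne (integral_nonneg fun k => by positivity) fun h => hq.ne ?_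
    have h0 := (integral_eq_zero_iff_of_nonneg (fun k => by positivity) hi).1 h.symm
    have hz : ∀ x, wave (testWave g) x = 0 := fun x => by
      rw [wave, integral_eq_zero_of_ae, mul_zero]
      filter_upwards [h0] with k hk
      have : ft g k = 0 := by simpa using hk
      simp [testWave, this]
    have : ((q : ℝ) : ℂ) = 0 := by
      rw [← hgq]
      simp [density, currentForm, hz]
    exact_mod_cast this
  set r : ℝ := (Real.sqrt N)⁻¹ with hr
  have hr2 : r ^ 2 * N = 1 := by
    rw [hr, inv_pow, Real.sq_sqrt hN0.le, inv_mul_cancel₀ hN0.ne']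
  have hr0 : 0 < r ^ 2 := by positivity
  have hft : ∀ k, ft ((r : ℂ) • g) k = r * ft g k := fun k => by
    simp only [ft, Pi.smul_apply, smul_eq_mul, mul_left_comm _ (r : ℂ), integral_const_mul]
  have hcoe : (((r : ℂ) • g : 𝓢(ℝ, ℂ)) : ℝ → ℂ) = (r : ℂ) • (g : ℝ → ℂ) := rfl
  have htw : testWave ((r : ℂ) • g) = fun k => r * testWave g k := by
    funext k
    simp only [testWave, hft, map_mul, conj_ofReal]
  refine ⟨(r : ℂ) • g, ⟨fun k hk => ?_, ?_⟩, r ^ 2 * q, mul_neg_of_pos_of_neg hr0 hq, ?_⟩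
  · rw [hcoe, hft, hg k hk, mul_zero]
  · simp only [hcoe, hft, norm_mul, mul_pow, norm_real, Real.norm_eq_abs, sq_abs]
    rw [integral_const_mul, hr2]
  -- The density is quadratic in the wave, so normalization multiplies the charge by the positive
  -- number `r ^ 2` and keeps its sign.
  · have hd : ∀ x, density (testWave ((r : ℂ) • g)) x =
        ((r ^ 2 : ℝ) : ℂ) * density (testWave g) x := fun x => by
      rw [htw]
      simp only [density, wave_ofReal_mul, waveDeriv_ofReal_mul, currentForm, map_mul, conj_ofReal]
      push_cast
      ring
    simp only [hcoe, hd]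
    rw [integral_const_mul, hgq, ofReal_mul]

/-- The outgoing charges of the black holes. -/
lemma integrable_and_integral_out {g : 𝓢(ℝ, ℂ)} (hg : ∀ k : ℝ, k < 0 → ft g k = 0) {X : ℝ → ℝ}
    (hX : X = rbh ∨ X = cghs) :
    Integrable (fun y => deriv X y * density (testWave g) (X y)) ∧
      ∫ y, deriv X y * density (testWave g) (X y) =
        ∫ x in Set.Iio 0, density (testWave g) x := by
  obtain ⟨h1, h2⟩ := isCoordChange_and_range hX
  have h3 := integrable_and_integral_comp h1 (integrable_density hg)
  rwa [h2] at h3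

end

end ChargedField

open ChargedField
theorem mainTheorem12 :
    (∀ g : SchwartzMap ℝ ℂ, IsNormalizedTest g → ∀ s : Scheme,
      ∃ J Jbar : ℝ → ℂ,
        (∀ x, HasInCurrent s (oneParticle g) x (J x)) ∧
        (∀ x, HasInCurrent s (oneAntiparticle g) x (Jbar x)) ∧
        (∀ x, J x = -Jbar x ∧
          J x = -(I / 4) * biDeriv (fun t => conj (primitive g t)) (primitive g) x) ∧
        (Integrable J ∧ Integrable Jbar ∧ (∫ x, J x) = 1 ∧ -(∫ x, Jbar x) = 1) ∧
        (∀ X : ℝ → ℝ, IsCoordChange X → ∃ Jout Joutbar : ℝ → ℂ,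
          (∀ y, HasOutCurrent s X (oneParticle g) y (Jout y)) ∧
          (∀ y, HasOutCurrent s X (oneAntiparticle g) y (Joutbar y)) ∧
          (∀ y, Jout y = -Joutbar y ∧
            Jout y = -(I / 4) *
              biDeriv (fun t => conj (primitive g (X t))) (fun t => primitive g (X t)) y) ∧
          (X = rbh ∨ X = cghs →
            Integrable Jout ∧ Integrable Joutbar ∧
            (∫ y, Jout y) = (∫ x in Set.Iio (0 : ℝ), J x) ∧
            -(∫ y, Joutbar y) = (∫ x in Set.Iio (0 : ℝ), J x)))) ∧
    (IsCoordChange rbh ∧ IsCoordChange cghs) ∧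
    (∃ g : SchwartzMap ℝ ℂ, IsNormalizedTest g ∧
      ∀ s : Scheme, ∀ X : ℝ → ℝ, X = rbh ∨ X = cghs →
        ∃ (Jout : ℝ → ℂ) (q : ℝ), (∀ y, HasOutCurrent s X (oneParticle g) y (Jout y)) ∧
          Integrable Jout ∧ (∫ y, Jout y) = (q : ℂ) ∧ q < 0) := by
  refine ⟨fun g hg s => ?_, ⟨isCoordChange_rbh, isCoordChange_cghs⟩, ?_⟩
  · have hw := isUnitWave_testWave hg
    have hp : oneParticle g = particle (testWave g) := oneParticle_eq g
    have ha : oneAntiparticle g = antiparticle (testWave g) := oneAntiparticle_eq g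
    have hi := integrable_density hg.1
    refine ⟨density (testWave g), fun x => -density (testWave g) x,
      fun x => hp ▸ (hw.hasInCurrent s x).1, fun x => ha ▸ (hw.hasInCurrent s x).2,
      fun x => ⟨(neg_neg _).symm, density_testWave_eq_biDeriv hg.1 x⟩,
      ⟨hi, hi.neg, integral_density hg, by rw [integral_neg, neg_neg, integral_density hg]⟩,
      fun X hX => ⟨fun y => deriv X y * density (testWave g) (X y),
        fun y => -(deriv X y * density (testWave g) (X y)),
        fun y => hp ▸ (hw.hasOutCurrent s hX y).1, fun y => ha ▸ (hw.hasOutCurrent s hX y).2,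
        fun y => ⟨(neg_neg _).symm, deriv_mul_density_eq_biDeriv hg.1 (hX.differentiable y)⟩,
        fun hX' => ?_⟩⟩
    obtain ⟨h1, h2⟩ := integrable_and_integral_out hg.1 hX'
    exact ⟨h1, h1.neg, h2, by rw [integral_neg, neg_neg, h2]⟩
  · obtain ⟨g, hg, q, hq, hgq⟩ := exists_negative_charge
    refine ⟨g, hg, fun s X hX => ⟨fun y => deriv X y * density (testWave g) (X y), q, fun y => ?_,
      ?_, ?_, hq⟩⟩
    · rw [show oneParticle g = particle (testWave g) from oneParticle_eq g]
      exact ((isUnitWave_testWave hg).hasOutCurrent s (isCoordChange_and_range hX).1 y).1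
    · exact (integrable_and_integral_out hg.1 hX).1
    · rw [(integrable_and_integral_out hg.1 hX).2, hgq]
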